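/- **Theorem 3.3 (Char-Ri).** Fix $T>0$ and set $X:=L^2((0,T);L^2(\mathbb R))$ (identified with $L^2((0,T)\times\mathbb R)$) and $Y:=X\cap L^1(0,T;\mathrm{BV}(\mathbb R))$. Elements $g\in X$ are regarded as elements of $X^*$ (and of $Y^*$) through $\langle g,v\rangle=\int_0^T\!\int_{\mathbb R}g\,v\,dx\,dt$. Let $\Psi:X\to[0,\infty]$, $\Psi(v):=\int_0^T|\mathrm D_xv(t)|(\mathbb R)\,dt$ if $v\in Y$ and $\Psi(v):=\infty$ otherwise, where $|\mathrm D_xv(t)|(\mathbb R)$ is the total variation of $v(t,\cdot)$. For $v\in X$ with $\Psi(v)<\infty$ let $\partial\Psi(v):=\{\eta\in X^*:\ \Psi(v)+\langle\eta,w-v\rangle\le\Psi(w)\ \text{for all }w\in X\}$. For $\varepsilon>0$ and $u^\varepsilon_{\rm in}\in H^2(\mathbb R)$, a solution $u^\varepsilon:[0,\infty)\times\mathbb R\to\mathbb R$ of the viscoplastic Burgers problem is a function with $u^\varepsilon\in L^\infty(0,S;H^2(\mathbb R))$ and $\partial_tu^\varepsilon\in L^\infty(0,S;L^2(\mathbb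 R))\cap L^2(0,S;H^1(\mathbb R))$ for all $S>0$, such that for all $\phi\in C^1_c([0,\infty)\times\mathbb R)$ $$\int_0^\infty\!\!\int_{\mathbb R}\Big(u^\varepsilon\partial_t\phi+\big(\tfrac{(u^\varepsilon)^2}{2}-\varepsilon\partial_xu^\varepsilon-R^\varepsilon\big)\partial_x\phi\Big)dx\,dt+\int_{\mathbb R}u^\varepsilon_{\rm in}\,\phi(0,\cdot)\,dx=0,\qquad R^\varepsilon:=\frac{\partial_xu^\varepsilon}{\sqrt{|\partial_xu^\varepsilon|^2+\varepsilon^2}} .$$ Then the following statements hold. 1. For every $\varepsilon>0$, every $u^\varepsilon_{\rm in}\in H^2(\mathbb R)$ and every such solution $u^\varepsilon$, the weak derivative $\partial_xR^\varepsilon$ exists in $X$ and $-\partial_xR^\varepsilon\in\partial\Psi(0)$. 2. Let $(\varepsilon_n)$ be a sequence of positive numbers with $\varepsilon_n\to0$, let $u^{\varepsilon_n}_{\rm in}\in H^2(\mathbb R)$ be initial data that are bounded in $L^2(\mathbb R)$ and of bounded total variation, uniformly in $n$, and let $u^{\varepsilon_n}$ be solutions as above. Let $R$ be the limit of the regularised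 stresses, i.e. $R^{\varepsilon_n}\overset{*}{\rightharpoonup}R$ in $L^\infty((0,S)\times(-r,r))$ for all $S,r>0$. Then there are a (further) subsequence and a $\zeta\in X^*$ such that along this subsequence $$-\partial_xR^{\varepsilon_n}\overset{*}{\rightharpoonup}\zeta\ \text{ in }Y^*,$$ and such that $\zeta=-\mathrm D_xR$ in the sense of distributions on $(0,T)\times\mathbb R$, i.e. $\langle\zeta,\phi\rangle=\int_0^T\!\int_{\mathbb R}R\,\partial_x\phi\,dx\,dt$ for all $\phi\in C_c^\infty((0,T)\times\mathbb R)$, and $\zeta\in\partial\Psi(0)$. -/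

import Mathlib

open MeasureTheory Set Filter Topology
open scoped ENNReal NNReal ContDiff

noncomputable section

namespace PlasticBurgers

/-- The space-time strip `(0,T) × ℝ`; points are pairs `(t, x)`. -/
def strip (T : ℝ) : Set (ℝ × ℝ) := Ioo 0 T ×ˢ univ

/-- Lebesgue measure on the strip. -/
abbrev stripMeasure (T : ℝ) : Measure (ℝ × ℝ) := volume.restrict (strip T)

/-- `X = L²((0,T); L²(ℝ))`, realised as `L²((0,T) × ℝ)`. -/
abbrev X (T : ℝ) : Type := Lp ℝ 2 (stripMeasure T)

/-- Partial derivative in time of a differentiable function. -/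
def dt (φ : ℝ × ℝ → ℝ) (p : ℝ × ℝ) : ℝ := fderiv ℝ φ p (1, 0)

/-- Partial derivative in space of a differentiable function. -/
def dx (φ : ℝ × ℝ → ℝ) (p : ℝ × ℝ) : ℝ := fderiv ℝ φ p (0, 1)

/-- `φ ∈ C_c^∞((0,T) × ℝ)`. -/
structure IsTest (T : ℝ) (φ : ℝ × ℝ → ℝ) : Prop where
  smooth : ContDiff ℝ ∞ φ
  compact : HasCompactSupport φ
  support : tsupport φ ⊆ strip T

theorem IsTest.memLp {T : ℝ} {φ : ℝ × ℝ → ℝ} (h : IsTest T φ) :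
    MemLp φ 2 (stripMeasure T) :=
  h.smooth.continuous.memLp_of_hasCompactSupport h.compact

/-- A test function as an element of `X`. -/
def IsTest.toX {T : ℝ} {φ : ℝ × ℝ → ℝ} (h : IsTest T φ) : X T := h.memLp.toLp φ

/-- `g` is the weak derivative `∂_x f` on `(0,T) × ℝ`. -/
structure HasWeakDx (T : ℝ) (f g : ℝ × ℝ → ℝ) : Prop where
  locInt_left : LocallyIntegrableOn f (strip T)
  locInt_right : LocallyIntegrableOn g (strip T)
  eq : ∀ φ : ℝ × ℝ → ℝ, IsTest T φ →
    ∫ p in strip T, f p * dx φ p = -∫ p in strip T, g p * φ p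

/-- `g` is the weak derivative `∂_t f` on `(0,T) × ℝ`. -/
structure HasWeakDt (T : ℝ) (f g : ℝ × ℝ → ℝ) : Prop where
  locInt_left : LocallyIntegrableOn f (strip T)
  locInt_right : LocallyIntegrableOn g (strip T)
  eq : ∀ φ : ℝ × ℝ → ℝ, IsTest T φ →
    ∫ p in strip T, f p * dt φ p = -∫ p in strip T, g p * φ p

/-- `g` is the weak derivative of `f` on `ℝ`. -/
structure HasWeakDeriv (f g : ℝ → ℝ) : Prop where
  locInt_left : LocallyIntegrable f
  locInt_right : LocallyIntegrable g
  eq : ∀ φ : ℝ → ℝ, ContDiff ℝ ∞ φ → HasCompactSupport φ →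
    ∫ x, f x * deriv φ x = -∫ x, g x * φ x

/-- `f ∈ H²(ℝ)`. -/
def MemH2 (f : ℝ → ℝ) : Prop :=
  ∃ f' f'' : ℝ → ℝ, HasWeakDeriv f f' ∧ HasWeakDeriv f' f'' ∧
    MemLp f 2 ∧ MemLp f' 2 ∧ MemLp f'' 2

/-- `f ∈ L^∞(0,T; L²(ℝ))`. -/
def MemLinftyL2 (T : ℝ) (f : ℝ × ℝ → ℝ) : Prop :=
  AEStronglyMeasurable f (stripMeasure T) ∧
    ∃ C : ℝ≥0, ∀ᵐ t ∂(volume.restrict (Ioo 0 T)),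
      eLpNorm (fun x => f (t, x)) 2 volume ≤ C

/-- The total variation `|Df|(ℝ) ∈ [0,∞]` of a locally integrable `f : ℝ → ℝ`, by duality with
`C_c^1` functions bounded by one. -/
def totalVariation (f : ℝ → ℝ) : ℝ≥0∞ :=
  ⨆ (φ : ℝ → ℝ) (_ : ContDiff ℝ 1 φ ∧ HasCompactSupport φ ∧ ∀ x, |φ x| ≤ 1),
    ENNReal.ofReal (∫ x, f x * deriv φ x)

/-- The norm of `BV(ℝ)`, with value `∞` outside of it. -/
def bvNorm (f : ℝ → ℝ) : ℝ≥0∞ := eLpNorm f 1 volume + totalVariation f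

/-- `f ∈ BV(ℝ)`. -/
def MemBV (f : ℝ → ℝ) : Prop := Integrable f ∧ totalVariation f < ⊤

/-- `Y = X ∩ L¹(0,T; BV(ℝ))`. -/
def Y (T : ℝ) : Set (X T) :=
  {v | (∀ᵐ t ∂(volume.restrict (Ioo 0 T)), MemBV fun x => v (t, x)) ∧
    ∫⁻ t in Ioo 0 T, bvNorm (fun x => v (t, x)) < ⊤}

open Classical in
/-- `Ψ(v) = ∫₀ᵀ |D_x v|(ℝ) dt` on `Y`, and `∞` on `X ∖ Y`. -/
def Psi (T : ℝ) (v : X T) : ℝ≥0∞ :=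
  if v ∈ Y T then ∫⁻ t in Ioo 0 T, totalVariation (fun x => v (t, x)) else ⊤

/-- The convex subdifferential `∂Φ(v) ⊆ E*` of `Φ : E → [0,∞]`. -/
def subdifferential {E : Type*} [NormedAddCommGroup E] [NormedSpace ℝ E] (Φ : E → ℝ≥0∞) (v : E) :
    Set (StrongDual ℝ E) :=
  {η | Φ v < ⊤ ∧ ∀ w : E, (Φ v : EReal) + ((η (w - v) : ℝ) : EReal) ≤ (Φ w : EReal)}

/-- The regularised stress `p / √(p² + ε²)`, evaluated at `p = ∂_x u`. -/
def stress (ε : ℝ) (ux : ℝ × ℝ → ℝ) (p : ℝ × ℝ) : ℝ := ux p / √(|ux p| ^ 2 + ε ^ 2)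

/-- `u`, with weak derivative `ux = ∂_x u`, is a global solution of the viscoplastic Burgers
equation `∂_t u + ∂_x (u²/2) - ∂_x (∂_x u / √(|∂_x u|² + ε²)) - ε ∂_x² u = 0` with initial datum
`uin`, in the regularity class `u ∈ L^∞(0,T; H²(ℝ))`,
`∂_t u ∈ L^∞(0,T; L²(ℝ)) ∩ L²(0,T; H¹(ℝ))` for every `T > 0`. -/
structure IsViscoplasticSolution (ε : ℝ) (uin : ℝ → ℝ) (u ux : ℝ × ℝ → ℝ) : Prop where
  weakDx : ∀ T > 0, HasWeakDx T u ux
  regularity : ∃ uxx ut utx : ℝ × ℝ → ℝ, ∀ T > 0,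
    HasWeakDx T ux uxx ∧ HasWeakDt T u ut ∧ HasWeakDx T ut utx ∧
    MemLinftyL2 T u ∧ MemLinftyL2 T ux ∧ MemLinftyL2 T uxx ∧ MemLinftyL2 T ut ∧
    MemLp ut 2 (stripMeasure T) ∧ MemLp utx 2 (stripMeasure T)
  weak_form : ∀ φ : ℝ × ℝ → ℝ, ContDiff ℝ 1 φ → HasCompactSupport φ →
    (∫ p in Ioi (0 : ℝ) ×ˢ (univ : Set ℝ),
        (u p * dt φ p + ((u p) ^ 2 / 2 - ε * ux p - stress ε ux p) * dx φ p))
      + ∫ x, uin x * φ (0, x) = 0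

/-- Weak-* convergence `F n ⇀ G` in `L^∞(μ) = (L¹(μ))*`. -/
def TendstoWeakStarLinfty {α : Type*} [MeasurableSpace α] (μ : Measure α)
    (F : ℕ → α → ℝ) (G : α → ℝ) : Prop :=
  (∀ n, MemLp (F n) ⊤ μ) ∧ MemLp G ⊤ μ ∧
    ∀ ψ : α → ℝ, Integrable ψ μ →
      Tendsto (fun n => ∫ p, F n p * ψ p ∂μ) atTop (𝓝 (∫ p, G p * ψ p ∂μ))

/-- The functional `v ↦ ∫∫ g v` on `X` given by `g ∈ X`. -/
def functional {T : ℝ} (g : X T) : StrongDual ℝ (X T) := InnerProductSpace.toDual ℝ (X T) g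

end PlasticBurgers

end

open PlasticBurgers

/-!
Write `R = p / √(p² + ε²)` with `p = ∂_x u` for the regularised stress of a solution `u`, and
`R_x = ε² (p² + ε²)^(-3/2) ∂_x² u` for its derivative, which lies in `L²((0,T) × ℝ)` for fixed `ε`.

*The element `-R_x` of `∂Ψ(0)`.* Since `Ψ(0) = 0`, one has to show `⟨-R_x, w⟩ ≤ Ψ(w)` for `w ∈ Y`.
For almost every `t` the slice `R(t, ·)` belongs to `H¹(ℝ)` and is bounded by one
(`HasWeakDx.ae_memH1`, `MemH1.regSign`). Test functions `φ` approximate it in `H¹(ℝ)`, hence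
uniformly, so that they may be used in the definition of the total variation up to a factor close
to one; therefore `-∫ R_x(t) w(t) dx ≤ |D_x w(t)|(ℝ)`
(`MemH1.integral_mul_deriv_le_totalVariation`). Integration over `t` gives the claim
(`functional_neg_weakDx_le`).

*The limit `ε → 0`.* The key is a bound for `R_x` in `L²((0,T) × ℝ)` which is uniform in `ε`
(`IsViscoplasticSolution.integral_stressDx_sq_le`):
`∫∫ R_x² ≤ exp (ε T) |D u_in|(ℝ)`.
It comes from testing the equation `∂_t u = R_x + ε ∂_x² u - u ∂_x u` with `-R_x`. With
`F(p) = √(p² + ε²) - ε`, whose derivative is `R`, and `E(t) = ∫ F(∂_x u(t)) dx`,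
* the time derivative gives `E'(t)`;
* the term `ε ∂_x² u` has the good sign;
* the convective term is `∫ u ∂_x u R_x = -∫ ∂_x u G(∂_x u)` with `G(p) = ε - ε² / √(p² + ε²)`, the
  primitive of `p F''(p)`, and `|p G(p)| ≤ ε F(p)` bounds it by `ε E(t)`
  (`MemH1.integral_sq_sub_le`).

So `E' + ∫ R_x² ≤ ε E`, and `E(0) ≤ |D u_in|(ℝ)`, again by duality, because `F(p) ≤ p R(p)`
(`MemH1.integral_regAbs_deriv_le`). The weight `exp (-ε t)` absorbs the term `ε E`.

The regularity of `u` in time is not used to differentiate `E`. Instead the weak formulation is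
turned into `u(t) = u_in + ∫₀ᵗ (R_x + ε ∂_x² u - u ∂_x u) ds`
(`IsViscoplasticSolution.ae_eq_add_integral`), `u` is extended by `u_in` to negative times, and
convexity of `F` is applied to the backward difference quotients `(u(t) - u(t - h)) / h`; the limit
`h → 0` only needs the continuity of translations in `L²` (`energy_inequality`).

Given the bound, the sequential Banach–Alaoglu theorem in `X` yields a subsequence along which
`-∂_x R^{ε_n}` converges weakly-* to some `ζ ∈ X*`, and `ζ = -D_x R` and `ζ ∈ ∂Ψ(0)` follow by
passing to the limit.
-/

namespace PlasticBurgers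

/-! ### Primitives of locally integrable functions -/

/-- `A` is a primitive of the locally integrable function `b`, that is, `A` is locally absolutely
continuous with derivative `b` almost everywhere. -/
structure IsPrimitive (A b : ℝ → ℝ) : Prop where
  locInt : LocallyIntegrable b
  sub_eq : ∀ x y, A y - A x = ∫ t in x..y, b t

namespace IsPrimitive
variable {A B a b : ℝ → ℝ}

theorem intervalIntegrable (h : IsPrimitive A b) (x y : ℝ) : IntervalIntegrable b volume x y :=
  intervalIntegrable_iff.mpr <|
    (h.locInt.integrableOn_isCompact isCompact_uIcc).mono_set uIoc_subset_uIcc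

theorem eq_add (h : IsPrimitive A b) (c : ℝ) : A = fun x => A c + ∫ t in c..x, b t := by
  funext x
  rw [← h.sub_eq]; ring

theorem of_integral (hb : LocallyIntegrable b) (c k : ℝ) :
    IsPrimitive (fun x => k + ∫ t in c..x, b t) b := by
  have hi (x y : ℝ) : IntervalIntegrable b volume x y := intervalIntegrable_iff.mpr <|
    (hb.integrableOn_isCompact isCompact_uIcc).mono_set uIoc_subset_uIcc
  refine ⟨hb, fun x y => ?_⟩
  have := intervalIntegral.integral_interval_sub_left (hi c y) (hi c x)
  linarith

theorem absolutelyContinuous (h : IsPrimitive A b) (p q : ℝ) :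
    AbsolutelyContinuousOnInterval A p q := by
  have h1 := (h.intervalIntegrable p q).absolutelyContinuousOnInterval_intervalIntegral
    (c := p) left_mem_uIcc
  have h2 : AbsolutelyContinuousOnInterval (fun _ : ℝ => A p) p q :=
    ((LipschitzWith.const (α := ℝ) (A p)).lipschitzOnWith
      (s := uIcc p q)).absolutelyContinuousOnInterval
  rw [h.eq_add p]
  exact h2.add h1

theorem continuous (h : IsPrimitive A b) : Continuous A := by
  refine continuous_iff_continuousAt.2 fun x => ?_
  refine ((h.absolutelyContinuous (x - 1) (x + 1)).continuousOn).continuousAt ?_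
  rw [uIcc_of_le (by linarith)]
  exact Icc_mem_nhds (by linarith) (by linarith)

theorem ae_hasDerivAt (h : IsPrimitive A b) : ∀ᵐ x, HasDerivAt A (b x) x := by
  filter_upwards [_root_.LocallyIntegrable.ae_hasDerivAt_integral h.locInt] with x hx
  rw [h.eq_add 0]
  simpa using (hx 0).const_add (A 0)

theorem of_absolutelyContinuous (h : ∀ p q, AbsolutelyContinuousOnInterval A p q)
    (hd : ∀ᵐ x, HasDerivAt A (b x) x) : IsPrimitive A b := by
  have e : deriv A =ᵐ[volume] b := hd.mono fun x hx => hx.deriv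
  refine ⟨?_, fun x y => ?_⟩
  · refine (locallyIntegrable_iff.2 fun K hK => ?_ : LocallyIntegrable (deriv A)).congr e
    obtain ⟨r, hr⟩ := hK.isBounded.subset_closedBall 0
    have h1 := (h (-r) r).intervalIntegrable_deriv
    rw [Real.closedBall_eq_Icc, zero_sub, zero_add] at hr
    rcases le_or_gt (-r) r with h0 | h0
    · rw [intervalIntegrable_iff_integrableOn_Icc_of_le h0] at h1
      exact h1.mono_set hr
    · rw [Icc_eq_empty (by linarith)] at hr
      simp [subset_empty_iff.1 hr]
  · rw [← (h x y).integral_deriv_eq_sub]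
    exact intervalIntegral.integral_congr_ae (e.mono fun x hx _ => hx)

theorem mul (hA : IsPrimitive A a) (hB : IsPrimitive B b) :
    IsPrimitive (fun x => A x * B x) (fun x => a x * B x + A x * b x) :=
  of_absolutelyContinuous
    (fun p q => (hA.absolutelyContinuous p q).fun_mul (hB.absolutelyContinuous p q)) <| by
    filter_upwards [hA.ae_hasDerivAt, hB.ae_hasDerivAt] with x h1 h2 using h1.mul h2

theorem comp (hA : IsPrimitive A a) {f f' : ℝ → ℝ} (hf : ∀ x, HasDerivAt f (f' x) x) {C : ℝ≥0}
    (hC : ∀ x, |f' x| ≤ C) :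
    IsPrimitive (fun x => f (A x)) (fun x => f' (A x) * a x) := by
  have hL : LipschitzWith C f := lipschitzWith_of_nnnorm_deriv_le (fun x => (hf x).differentiableAt)
    fun x => by
      rw [(hf x).deriv, ← NNReal.coe_le_coe]; simpa using hC x
  refine of_absolutelyContinuous (fun p q => ?_) ?_
  · have h1 := hA.absolutelyContinuous p q
    unfold AbsolutelyContinuousOnInterval at h1 ⊢
    have h3 := h1.const_mul (C : ℝ)
    rw [mul_zero] at h3
    refine squeeze_zero (fun E => Finset.sum_nonneg fun _ _ => dist_nonneg) (fun E => ?_) h3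
    rw [Finset.mul_sum]
    exact Finset.sum_le_sum fun i _ => hL.dist_le_mul _ _
  · filter_upwards [hA.ae_hasDerivAt] with x h1 using (hf (A x)).comp x h1

theorem of_contDiff (hA : ContDiff ℝ 1 A) : IsPrimitive A (deriv A) := by
  have hc : Continuous (deriv A) := hA.continuous_deriv le_rfl
  exact ⟨hc.locallyIntegrable, fun x y => (intervalIntegral.integral_deriv_eq_sub
    (fun z _ => (hA.differentiable one_ne_zero z)) (hc.intervalIntegrable _ _)).symm⟩

/-- An integrable primitive of an integrable function vanishes at `-∞`. -/
theorem tendsto_atBot (h : IsPrimitive A b) (hA : Integrable A) (hb : Integrable b) :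
    Tendsto A atBot (𝓝 0) := by
  have h1 := intervalIntegral_tendsto_integral_Iic (μ := volume) 0 hb.integrableOn tendsto_id
  have h2 : Tendsto A atBot (𝓝 (A 0 - ∫ x in Iic 0, b x)) := by
    refine (h1.const_sub (A 0)).congr fun x => ?_
    rw [← h.sub_eq]; simp
  have h3 := IntegrableAtFilter.eq_zero_of_tendsto (l := atBot) (hA.integrableAtFilter _) ?_ h2
  · rwa [h3] at h2
  · intro s hs
    obtain ⟨c, hc⟩ := mem_atBot_sets.1 hs
    exact top_le_iff.1 ((by simp : volume (Iic c) = ⊤) ▸ measure_mono fun x hx => hc x hx)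

theorem tendsto_atTop (h : IsPrimitive A b) (hA : Integrable A) (hb : Integrable b) :
    Tendsto A atTop (𝓝 0) := by
  have h1 := intervalIntegral_tendsto_integral_Ioi (μ := volume) 0 hb.integrableOn tendsto_id
  have h2 : Tendsto A atTop (𝓝 (A 0 + ∫ x in Ioi 0, b x)) := by
    refine (h1.const_add (A 0)).congr fun x => ?_
    rw [← h.sub_eq]; simp
  have h3 := IntegrableAtFilter.eq_zero_of_tendsto (l := atTop) (hA.integrableAtFilter _) ?_ h2
  · rwa [h3] at h2
  · intro s hs
    obtain ⟨c, hc⟩ := mem_atTop_sets.1 hs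
    exact top_le_iff.1 ((by simp : volume (Ici c) = ⊤) ▸ measure_mono fun x hx => hc x hx)

theorem integral_eq_zero (h : IsPrimitive A b) (hA : Integrable A) (hb : Integrable b) :
    ∫ x, b x = 0 := by
  have h1 := intervalIntegral_tendsto_integral (μ := volume) hb tendsto_neg_atTop_atBot tendsto_id
  have h2 := (h.tendsto_atTop hA hb).sub ((h.tendsto_atBot hA hb).comp tendsto_neg_atTop_atBot)
  rw [sub_zero] at h2
  exact tendsto_nhds_unique h1 (h2.congr fun x => by simp [h.sub_eq])

theorem abs_le (h : IsPrimitive A b) (hA : Integrable A) (hb : Integrable b) (x : ℝ) :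
    |A x| ≤ ∫ y, |b y| := by
  have h2 := ((h.tendsto_atBot hA hb).const_sub (A x)).abs
  rw [sub_zero] at h2
  refine le_of_tendsto h2 ?_
  filter_upwards [eventually_le_atBot x] with y hy
  rw [h.sub_eq, intervalIntegral.integral_of_le hy]
  exact (abs_integral_le_integral_abs).trans
    (setIntegral_le_integral hb.abs (Eventually.of_forall fun _ => abs_nonneg _))

end IsPrimitive

/-! ### The space `H¹(ℝ)` -/

/-- Primitives have weak derivatives. -/
theorem IsPrimitive.integral_mul_deriv {B b φ : ℝ → ℝ} (hB : IsPrimitive B b)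
    (hφ : ContDiff ℝ 1 φ) (hc : HasCompactSupport φ) :
    ∫ x, B x * deriv φ x = -∫ x, b x * φ x := by
  have hφ' : Continuous (deriv φ) := hφ.continuous_deriv le_rfl
  have i1 : Integrable (fun x => B x * deriv φ x) :=
    (hB.continuous.mul hφ').integrable_of_hasCompactSupport hc.deriv.mul_left
  have i2 : Integrable (fun x => b x * φ x) :=
    hB.locInt.integrable_smul_right_of_hasCompactSupport hφ.continuous hc
  have h := (hB.mul (IsPrimitive.of_contDiff hφ)).integral_eq_zero
    ((hB.continuous.mul hφ.continuous).integrable_of_hasCompactSupport hc.mul_left) (i2.add i1)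
  rw [integral_add i2 i1] at h
  linarith

/-- A test function of mean zero is the derivative of a test function. -/
theorem exists_antideriv {γ : ℝ → ℝ} (hγ : ContDiff ℝ ∞ γ) (hc : HasCompactSupport γ)
    (h0 : ∫ x, γ x = 0) :
    ∃ β : ℝ → ℝ, ContDiff ℝ ∞ β ∧ HasCompactSupport β ∧ deriv β = γ := by
  obtain ⟨r, hr0, hr⟩ := hc.isCompact.isBounded.subset_ball_lt 0 0
  rw [Real.ball_eq_Ioo, zero_sub, zero_add] at hr
  have hz : ∀ x, x ∉ Ioo (-r) r → γ x = 0 := fun x hx => by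
    by_contra h; exact hx (hr (subset_tsupport _ h))
  have hd : ∀ x, HasDerivAt (fun x => ∫ t in (-r)..x, γ t) (γ x) x := fun x =>
    intervalIntegral.integral_hasDerivAt_right (hγ.continuous.intervalIntegrable _ _)
      hγ.continuous.aestronglyMeasurable.stronglyMeasurableAtFilter hγ.continuous.continuousAt
  have hd' : deriv (fun x => ∫ t in (-r)..x, γ t) = γ := funext fun x => (hd x).deriv
  refine ⟨fun x => ∫ t in (-r)..x, γ t, ?_, ?_, hd'⟩
  · rw [contDiff_infty_iff_deriv]
    exact ⟨fun x => (hd x).differentiableAt, hd'.symm ▸ hγ⟩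
  · refine HasCompactSupport.of_support_subset_isCompact (isCompact_Icc (a := -r) (b := r)) ?_
    intro x hx
    by_contra hxr
    apply hx
    change ∫ t in (-r)..x, γ t = 0
    rcases lt_or_ge x (-r) with h | h
    · refine intervalIntegral.integral_zero_ae (Eventually.of_forall fun t ht => hz t ?_)
      rw [uIoc_comm, uIoc_of_le h.le] at ht
      exact fun h' => absurd h'.1 (not_lt.2 ht.2)
    · have hx' : r < x := not_le.1 fun h' => hxr ⟨h, h'⟩
      rw [intervalIntegral.integral_eq_integral_of_support_subset, h0]
      intro t ht
      have := hr (subset_tsupport _ ht)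
      exact ⟨this.1, this.2.le.trans hx'.le⟩

/-- `a ∈ H¹(ℝ)`, with weak derivative `b`. Unlike in `HasWeakDeriv`, both functions are required to
be square integrable. -/
structure MemH1 (a b : ℝ → ℝ) : Prop where
  memLp : MemLp a 2
  memLp_deriv : MemLp b 2
  eq : ∀ φ : ℝ → ℝ, ContDiff ℝ ∞ φ → HasCompactSupport φ →
    ∫ x, a x * deriv φ x = -∫ x, b x * φ x

theorem _root_.MeasureTheory.MemLp.integrable_mul_two {α : Type*} [MeasurableSpace α]
    {μ : Measure α} {f g : α → ℝ} (hf : MemLp f 2 μ) (hg : MemLp g 2 μ) :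
    Integrable (fun x => f x * g x) μ := hf.integrable_mul hg

namespace MemH1
variable {a b p q : ℝ → ℝ}

theorem congr (h : MemH1 a b) (ha : a =ᵐ[volume] p) (hb : b =ᵐ[volume] q) : MemH1 p q := by
  refine ⟨h.memLp.ae_eq ha, h.memLp_deriv.ae_eq hb, fun φ h1 h2 => ?_⟩
  rw [← integral_congr_ae (ha.mono fun x hx => by simp only [hx] :
      (fun x => a x * deriv φ x) =ᵐ[volume] fun x => p x * deriv φ x),
    ← integral_congr_ae (hb.mono fun x hx => by simp only [hx] :
      (fun x => b x * φ x) =ᵐ[volume] fun x => q x * φ x), h.eq φ h1 h2]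

theorem of_isPrimitive {A : ℝ → ℝ} (h : IsPrimitive A b) (hA : MemLp A 2) (hb : MemLp b 2) :
    MemH1 A b :=
  ⟨hA, hb, fun _ h1 h2 => h.integral_mul_deriv (h1.of_le (by simp)) h2⟩

theorem of_contDiff {φ : ℝ → ℝ} (hφ : ContDiff ℝ ∞ φ) (hc : HasCompactSupport φ) :
    MemH1 φ (deriv φ) :=
  have h1 : ContDiff ℝ 1 φ := hφ.of_le (by simp)
  of_isPrimitive (IsPrimitive.of_contDiff h1) (hφ.continuous.memLp_of_hasCompactSupport hc)
    ((h1.continuous_deriv le_rfl).memLp_of_hasCompactSupport hc.deriv)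

theorem sub (h : MemH1 a b) (k : MemH1 p q) :
    MemH1 (fun x => a x - p x) (fun x => b x - q x) := by
  refine ⟨h.memLp.sub k.memLp, h.memLp_deriv.sub k.memLp_deriv, fun φ h1 h2 => ?_⟩
  have hφ := of_contDiff h1 h2
  simp only [sub_mul]
  rw [integral_sub (h.memLp.integrable_mul_two hφ.memLp_deriv)
    (k.memLp.integrable_mul_two hφ.memLp_deriv),
    integral_sub (h.memLp_deriv.integrable_mul_two hφ.memLp)
    (k.memLp_deriv.integrable_mul_two hφ.memLp), h.eq φ h1 h2, k.eq φ h1 h2]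
  ring

/-- The absolutely continuous representative (du Bois-Reymond): if `B` is a primitive of `b`, then
`a - B` integrates to zero against every test function of mean zero, so it is constant. -/
theorem exists_isPrimitive (h : MemH1 a b) : ∃ A, IsPrimitive A b ∧ a =ᵐ[volume] A := by
  have hbl : LocallyIntegrable b := h.memLp_deriv.locallyIntegrable (by norm_num)
  have hal : LocallyIntegrable a := h.memLp.locallyIntegrable (by norm_num)
  let ψ : ContDiffBump (0 : ℝ) := ⟨1, 2, one_pos, by norm_num⟩
  let ρ : ℝ → ℝ := ψ.normed volume
  have hρ : ContDiff ℝ ∞ ρ := ψ.contDiff_normed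
  have hρc : HasCompactSupport ρ := ψ.hasCompactSupport_normed
  have hρi : ∫ x, ρ x = 1 := ψ.integral_normed
  let B : ℝ → ℝ := fun x => 0 + ∫ t in 0..x, b t
  have hB : IsPrimitive B b := .of_integral hbl 0 0
  let c : ℝ := ∫ x, (a x - B x) * ρ x
  have hwl : LocallyIntegrable (fun x => a x - B x) := hal.sub hB.continuous.locallyIntegrable
  have hint : ∀ γ : ℝ → ℝ, ContDiff ℝ ∞ γ → HasCompactSupport γ →
      Integrable (fun x => (a x - B x) * γ x) := fun γ h1 h2 =>
    hwl.integrable_smul_right_of_hasCompactSupport h1.continuous h2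
  refine ⟨fun x => c + B x, ?_, ?_⟩
  · convert IsPrimitive.of_integral hbl 0 c using 2
    simp [B]
  · have key : ∀ᵐ x, (a x - B x) - c = 0 := by
      refine ae_eq_zero_of_integral_contDiff_smul_eq_zero
        (hwl.sub (locallyIntegrable_const c)) fun γ h1 h2 => ?_
      have hγi : Integrable γ := h1.continuous.integrable_of_hasCompactSupport h2
      have hρint : Integrable ρ := hρ.continuous.integrable_of_hasCompactSupport hρc
      set m := ∫ x, γ x with hm
      have hs : ContDiff ℝ ∞ (fun x => γ x - m * ρ x) := h1.sub (contDiff_const.mul hρ)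
      have hsc : HasCompactSupport (fun x => γ x - m * ρ x) := h2.sub hρc.mul_left
      obtain ⟨β, hβ, hβc, hβd⟩ := exists_antideriv hs hsc (by
        rw [integral_sub hγi (hρint.const_mul m), integral_const_mul, hρi]; simp [hm])
      have e1 := h.eq β hβ hβc
      have e2 := hB.integral_mul_deriv (hβ.of_le (by simp)) hβc
      have i1 : Integrable (fun x => a x * deriv β x) := by
        rw [hβd]; exact hal.integrable_smul_right_of_hasCompactSupport hs.continuous hsc
      have i2 : Integrable (fun x => B x * deriv β x) := by
        rw [hβd]
        exact hB.continuous.locallyIntegrable.integrable_smul_right_of_hasCompactSupport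
          hs.continuous hsc
      have e3 : ∫ x, (a x - B x) * (γ x - m * ρ x) = 0 := by
        rw [← sub_eq_zero.2 (e1.trans e2.symm), ← integral_sub i1 i2, hβd]
        exact integral_congr_ae (.of_forall fun x => by ring)
      have e4 : ∫ x, (a x - B x) * (γ x - m * ρ x)
          = (∫ x, (a x - B x) * γ x) - m * c := by
        rw [← integral_const_mul, ← integral_sub (hint γ h1 h2) ((hint ρ hρ hρc).const_mul m)]
        exact integral_congr_ae (.of_forall fun x => by simp only; ring)
      have e5 : ∫ x, γ x • (a x - B x - c) = (∫ x, (a x - B x) * γ x) - m * c := by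
        rw [hm, ← integral_mul_const, ← integral_sub (hint γ h1 h2) (hγi.mul_const c)]
        exact integral_congr_ae (.of_forall fun x => by simp only [smul_eq_mul]; ring)
      rw [e5, ← e4, e3]
    filter_upwards [key] with x hx
    linarith

/-- Integration by parts in `H¹(ℝ)`. The product of the two absolutely continuous representatives
is integrable together with its derivative, so there are no boundary terms at infinity. -/
theorem integral_mul_eq_neg (h : MemH1 a b) (k : MemH1 p q) :
    ∫ x, a x * q x = -∫ x, b x * p x := by
  obtain ⟨A, hA, ea⟩ := h.exists_isPrimitive
  obtain ⟨P, hP, ep⟩ := k.exists_isPrimitive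
  have hA2 := h.memLp.ae_eq ea
  have hP2 := k.memLp.ae_eq ep
  have i1 := h.memLp_deriv.integrable_mul_two hP2
  have i2 := hA2.integrable_mul_two k.memLp_deriv
  have := (hA.mul hP).integral_eq_zero (hA2.integrable_mul_two hP2) (i1.add i2)
  rw [integral_add i1 i2] at this
  rw [integral_congr_ae (ea.mono fun x hx => by simp only [hx] :
      (fun x => a x * q x) =ᵐ[volume] fun x => A x * q x),
    integral_congr_ae (ep.mono fun x hx => by simp only [hx] :
      (fun x => b x * p x) =ᵐ[volume] fun x => b x * P x)]
  linarith

/-- The embedding of `H¹(ℝ)` into `L^∞(ℝ)`. -/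
theorem sq_le (h : MemH1 a b) : ∀ᵐ x, a x ^ 2 ≤ 2 * ∫ y, |a y * b y| := by
  obtain ⟨A, hA, ea⟩ := h.exists_isPrimitive
  have hA2 := h.memLp.ae_eq ea
  have i1 := h.memLp_deriv.integrable_mul_two hA2
  have i2 := hA2.integrable_mul_two h.memLp_deriv
  have h1 := (hA.mul hA).abs_le (hA2.integrable_mul_two hA2) (i1.add i2)
  filter_upwards [ea] with x hx
  rw [hx, pow_two, ← integral_const_mul]
  refine (le_abs_self _).trans ((h1 x).trans_eq (integral_congr_ae ?_))
  filter_upwards [ea] with y hy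
  rw [hy, show b y * A y + A y * b y = 2 * (A y * b y) by ring, abs_mul, abs_two]

/-- The weak derivative of `a² / 2` is `a a'`. -/
theorem integral_sq_mul_deriv (h : MemH1 a b) {φ : ℝ → ℝ} (hφ : ContDiff ℝ 1 φ)
    (hc : HasCompactSupport φ) :
    ∫ x, a x ^ 2 / 2 * deriv φ x = -∫ x, a x * b x * φ x := by
  obtain ⟨A, hA, ea⟩ := h.exists_isPrimitive
  have e := (hA.mul hA).integral_mul_deriv hφ hc
  have e1 : ∫ x, a x ^ 2 / 2 * deriv φ x = 2⁻¹ * ∫ x, A x * A x * deriv φ x := by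
    rw [← integral_const_mul]
    exact integral_congr_ae (ea.mono fun x hx => by simp only [hx]; ring)
  have e2 : ∫ x, a x * b x * φ x = 2⁻¹ * ∫ x, (b x * A x + A x * b x) * φ x := by
    rw [← integral_const_mul]
    exact integral_congr_ae (ea.mono fun x hx => by simp only [hx]; ring)
  rw [e1, e2, e]; ring

/-- The chain rule for `C¹` functions with bounded derivative that vanish at the origin. -/
theorem comp (h : MemH1 a b) {f f' : ℝ → ℝ} (hf : ∀ x, HasDerivAt f (f' x) x)
    (hf' : Continuous f') (h0 : f 0 = 0) {C : ℝ≥0} (hC : ∀ x, |f' x| ≤ C) :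
    MemH1 (fun x => f (a x)) (fun x => f' (a x) * b x) := by
  obtain ⟨A, hA, ea⟩ := h.exists_isPrimitive
  have hA2 := h.memLp.ae_eq ea
  have hL : LipschitzWith C f := lipschitzWith_of_nnnorm_deriv_le (fun x => (hf x).differentiableAt)
    fun x => by
      rw [(hf x).deriv, ← NNReal.coe_le_coe]; simpa using hC x
  refine (of_isPrimitive (hA.comp hf hC) ?_ ?_).congr
    (ea.mono fun x hx => by simp only [hx]) (ea.mono fun x hx => by simp only [hx])
  · refine hA2.of_le_mul (c := C) (hL.continuous.comp_aestronglyMeasurable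
      hA2.aestronglyMeasurable) (.of_forall fun x => ?_)
    have := hL.dist_le_mul (A x) 0
    rwa [h0, dist_zero_right, dist_zero_right] at this
  · refine h.memLp_deriv.of_le_mul (c := C) ((hf'.comp_aestronglyMeasurable
      hA2.aestronglyMeasurable).mul h.memLp_deriv.aestronglyMeasurable) (.of_forall fun x => ?_)
    rw [norm_mul]
    exact mul_le_mul_of_nonneg_right (hC _) (norm_nonneg _)

end MemH1

/-! ### Density of test functions in `H¹(ℝ)` and duality with the total variation -/

/-- The Hilbert space `L²(ℝ) × L²(ℝ)`. -/
abbrev L2Pair : Type := WithLp 2 (Lp ℝ 2 (volume : Measure ℝ) × Lp ℝ 2 (volume : Measure ℝ))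

/-- A pair of square integrable functions as an element of `L²(ℝ) × L²(ℝ)`. -/
noncomputable def L2Pair.mk {a b : ℝ → ℝ} (ha : MemLp a 2) (hb : MemLp b 2) : L2Pair :=
  WithLp.toLp 2 (ha.toLp a, hb.toLp b)

/-- The subspace of `L²(ℝ) × L²(ℝ)` of the pairs `(φ, φ')` with `φ ∈ C_c^∞(ℝ)`. -/
def testGraph : Submodule ℝ L2Pair where
  carrier := {z | ∃ φ : ℝ → ℝ, ContDiff ℝ ∞ φ ∧ HasCompactSupport φ ∧
    z.fst =ᵐ[volume] φ ∧ z.snd =ᵐ[volume] deriv φ}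
  zero_mem' := ⟨0, contDiff_const, .zero, Lp.coeFn_zero _ _ _, by
    simpa using! Lp.coeFn_zero ℝ 2 (volume : Measure ℝ)⟩
  add_mem' := by
    rintro z w ⟨φ, h1, h2, h3, h4⟩ ⟨ψ, k1, k2, k3, k4⟩
    refine ⟨φ + ψ, h1.add k1, h2.add k2, (Lp.coeFn_add _ _).trans (h3.add k3),
      (Lp.coeFn_add _ _).trans ((h4.add k4).trans (.of_forall fun x => ?_))⟩
    exact (deriv_add (h1.differentiable (by simp) x) (k1.differentiable (by simp) x)).symm
  smul_mem' := by
    rintro c z ⟨φ, h1, h2, h3, h4⟩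
    refine ⟨c • φ, h1.const_smul c, h2.smul_left (f := fun _ => c),
      (Lp.coeFn_smul _ _).trans (h3.const_smul c),
      (Lp.coeFn_smul _ _).trans ((h4.const_smul c).trans (.of_forall fun x => ?_))⟩
    exact (deriv_const_smul c (h1.differentiable (by simp) x)).symm

theorem L2Pair.inner_eq (z w : L2Pair) :
    inner ℝ z w = (∫ x, z.fst x * w.fst x) + ∫ x, z.snd x * w.snd x := by
  rw [WithLp.prod_inner_apply, L2.inner_def, L2.inner_def]
  simp [mul_comm]

theorem L2Pair.inner_mk {a b p q : ℝ → ℝ} (ha : MemLp a 2) (hb : MemLp b 2) {z : L2Pair}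
    (h1 : z.fst =ᵐ[volume] p) (h2 : z.snd =ᵐ[volume] q) :
    inner ℝ (L2Pair.mk ha hb) z = (∫ x, a x * p x) + ∫ x, b x * q x := by
  rw [L2Pair.inner_eq]
  congr 1
  · refine integral_congr_ae ?_
    filter_upwards [ha.coeFn_toLp, h1] with x e1 e2
    rw [← e1, ← e2]; rfl
  · refine integral_congr_ae ?_
    filter_upwards [hb.coeFn_toLp, h2] with x e1 e2
    rw [← e1, ← e2]; rfl

/-- Test functions are dense in `H¹(ℝ)`: a pair `(p, q)` orthogonal to all `(φ, φ')` satisfies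
`q' = p` weakly, and is then orthogonal to all of `H¹(ℝ)` by integration by parts. -/
theorem MemH1.mem_closure_testGraph {a b : ℝ → ℝ} (h : MemH1 a b) :
    L2Pair.mk h.memLp h.memLp_deriv ∈ testGraph.topologicalClosure := by
  rw [← Submodule.orthogonal_orthogonal_eq_closure, Submodule.mem_orthogonal']
  intro w hw
  rw [Submodule.mem_orthogonal'] at hw
  have hk : MemH1 (w.snd : ℝ → ℝ) (w.fst : ℝ → ℝ) := by
    refine ⟨Lp.memLp _, Lp.memLp _, fun φ h1 h2 => ?_⟩
    have hφ := MemH1.of_contDiff h1 h2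
    have := hw (L2Pair.mk hφ.memLp hφ.memLp_deriv)
      ⟨φ, h1, h2, hφ.memLp.coeFn_toLp, hφ.memLp_deriv.coeFn_toLp⟩
    rw [real_inner_comm, L2Pair.inner_mk hφ.memLp hφ.memLp_deriv (ae_eq_refl _) (ae_eq_refl _)]
      at this
    simp only [mul_comm (φ _), mul_comm (deriv φ _)] at this
    linarith
  rw [L2Pair.inner_mk _ _ (ae_eq_refl _) (ae_eq_refl _), h.integral_mul_eq_neg hk]
  ring

theorem MemH1.exists_test_approx {a b : ℝ → ℝ} (h : MemH1 a b) {δ : ℝ} (hδ : 0 < δ) :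
    ∃ φ : ℝ → ℝ, ContDiff ℝ ∞ φ ∧ HasCompactSupport φ ∧
      (∫ x, (a x - φ x) ^ 2) + ∫ x, (b x - deriv φ x) ^ 2 ≤ δ ^ 2 := by
  obtain ⟨z, ⟨φ, h1, h2, h3, h4⟩, hz⟩ := Metric.mem_closure_iff.1 h.mem_closure_testGraph δ hδ
  refine ⟨φ, h1, h2, ?_⟩
  rw [dist_eq_norm] at hz
  have e : ‖L2Pair.mk h.memLp h.memLp_deriv - z‖ ^ 2
      = (∫ x, (a x - φ x) ^ 2) + ∫ x, (b x - deriv φ x) ^ 2 := by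
    rw [← real_inner_self_eq_norm_sq, L2Pair.inner_eq]
    congr 1
    · refine integral_congr_ae ?_
      filter_upwards [h.memLp.coeFn_toLp, h3, Lp.coeFn_sub (h.memLp.toLp a) z.fst] with x e1 e2 e3
      rw [← e1, ← e2, pow_two]
      exact congrArg₂ _ e3 e3
    · refine integral_congr_ae ?_
      filter_upwards [h.memLp_deriv.coeFn_toLp, h4,
        Lp.coeFn_sub (h.memLp_deriv.toLp b) z.snd] with x e1 e2 e3
      rw [← e1, ← e2, pow_two]
      exact congrArg₂ _ e3 e3
  rw [← e]
  exact pow_le_pow_left₀ (norm_nonneg _) hz.le 2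

/-- Countably many test functions suffice to test identities that are linear in `φ` and `φ'` with
square integrable coefficients; a null set of times can therefore be chosen independently of `φ`. -/
theorem exists_countable_test : ∃ D : ℕ → ℝ → ℝ,
    (∀ n, ContDiff ℝ ∞ (D n) ∧ HasCompactSupport (D n)) ∧
    ∀ a b : ℝ → ℝ, MemLp a 2 → MemLp b 2 →
      (∀ n, (∫ x, a x * D n x) + ∫ x, b x * deriv (D n) x = 0) →
      ∀ φ : ℝ → ℝ, ContDiff ℝ ∞ φ → HasCompactSupport φ →
        (∫ x, a x * φ x) + ∫ x, b x * deriv φ x = 0 := by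
  have : Fact ((2 : ℝ≥0∞) ≠ ⊤) := ⟨by simp⟩
  choose D h1 h2 h3 h4 using fun n => (TopologicalSpace.denseSeq testGraph n).2
  refine ⟨D, fun n => ⟨h1 n, h2 n⟩, fun a b ha hb h φ k1 k2 => ?_⟩
  have hφ := MemH1.of_contDiff k1 k2
  have e : (fun z : testGraph => inner ℝ (L2Pair.mk ha hb) (z : L2Pair)) = fun _ => 0 := by
    refine (TopologicalSpace.denseRange_denseSeq testGraph).equalizer
      (continuous_const.inner continuous_subtype_val) continuous_const (funext fun n => ?_)
    exact (L2Pair.inner_mk ha hb (h3 n) (h4 n)).trans (h n)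
  have := congrFun e ⟨L2Pair.mk hφ.memLp hφ.memLp_deriv,
      ⟨φ, k1, k2, hφ.memLp.coeFn_toLp, hφ.memLp_deriv.coeFn_toLp⟩⟩
  exact (L2Pair.inner_mk ha hb (z := L2Pair.mk hφ.memLp hφ.memLp_deriv) hφ.memLp.coeFn_toLp
    hφ.memLp_deriv.coeFn_toLp).symm.trans this

/-- The Cauchy–Schwarz inequality. -/
theorem integral_mul_sq_le {α : Type*} [MeasurableSpace α] {μ : Measure α} {f g : α → ℝ}
    (hf : MemLp f 2 μ) (hg : MemLp g 2 μ) :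
    (∫ x, f x * g x ∂μ) ^ 2 ≤ (∫ x, f x ^ 2 ∂μ) * ∫ x, g x ^ 2 ∂μ := by
  have key : ∀ {p q : α → ℝ} (hp : MemLp p 2 μ) (hq : MemLp q 2 μ),
      inner ℝ (hp.toLp p) (hq.toLp q) = ∫ x, p x * q x ∂μ := fun {p q} hp hq => by
    rw [L2.inner_def]
    refine integral_congr_ae ?_
    filter_upwards [hp.coeFn_toLp, hq.coeFn_toLp] with x e1 e2
    rw [e1, e2]; simp [mul_comm]
  have := real_inner_mul_inner_self_le (hf.toLp f) (hg.toLp g)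
  rw [key, key, key] at this
  simpa only [pow_two] using this

/-- Functions of `H¹(ℝ)` bounded by one may be used in the definition of the total variation of
`w ∈ L²(ℝ)`. An approximating test function that is `δ`-close in `H¹(ℝ)` is uniformly `δ`-close,
hence bounded by `1 + δ`. -/
theorem MemH1.integral_mul_deriv_le_totalVariation {r r' w : ℝ → ℝ} (h : MemH1 r r')
    (hr : ∀ x, |r x| ≤ 1) (hw : MemLp w 2) (htv : totalVariation w ≠ ⊤) :
    ∫ x, w x * r' x ≤ (totalVariation w).toReal := by
  set V := (totalVariation w).toReal with hV
  have main : ∀ δ : ℝ, 0 < δ → ∫ x, w x * r' x ≤ (1 + δ) * V + δ * √(∫ x, w x ^ 2) := by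
    intro δ hδ
    obtain ⟨φ, h1, h2, h3⟩ := h.exists_test_approx hδ
    have hφ := MemH1.of_contDiff h1 h2
    have hd := h.sub hφ
    have n1 : 0 ≤ ∫ x, (r x - φ x) ^ 2 := integral_nonneg fun _ => sq_nonneg _
    have n2 : 0 ≤ ∫ x, (r' x - deriv φ x) ^ 2 := integral_nonneg fun _ => sq_nonneg _
    have hs : 2 * ∫ y, |(r y - φ y) * (r' y - deriv φ y)| ≤ δ ^ 2 := by
      refine le_trans ?_ h3
      rw [← integral_const_mul, ← integral_add hd.memLp.integrable_sq hd.memLp_deriv.integrable_sq]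
      refine integral_mono (((hd.memLp.integrable_mul_two hd.memLp_deriv).abs).const_mul 2)
        (hd.memLp.integrable_sq.add hd.memLp_deriv.integrable_sq) fun x => ?_
      simp only [abs_mul]
      nlinarith [sq_nonneg (|r x - φ x| - |r' x - deriv φ x|), sq_abs (r x - φ x),
        sq_abs (r' x - deriv φ x)]
    have hb : ∀ᵐ x, |φ x| ≤ 1 + δ := by
      filter_upwards [hd.sq_le] with x hx
      have h5 : |r x - φ x| ≤ δ := abs_le_of_sq_le_sq (hx.trans hs) hδ.le
      have h6 := abs_sub_abs_le_abs_sub (φ x) (r x)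
      rw [abs_sub_comm] at h6
      linarith [hr x]
    have hb' : ∀ x, |φ x| ≤ 1 + δ := by
      have hcl : IsClosed {x | |φ x| ≤ 1 + δ} :=
        isClosed_le h1.continuous.abs continuous_const
      have hdense : Dense {x | |φ x| ≤ 1 + δ} := Measure.dense_of_ae hb
      intro x
      have := hdense x
      rwa [hcl.closure_eq] at this
    have htest : ENNReal.ofReal (∫ x, w x * deriv (fun y => (1 + δ)⁻¹ * φ y) x)
        ≤ totalVariation w := by
      refine le_iSup₂_of_le (fun y => (1 + δ)⁻¹ * φ y) ⟨?_, h2.mul_left, fun x => ?_⟩ le_rfl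
      · exact contDiff_const.mul (h1.of_le (by simp))
      · rw [abs_mul, abs_of_pos (by positivity), inv_mul_le_iff₀ (by positivity), mul_one]
        exact hb' x
    have e1 : ∫ x, w x * deriv (fun y => (1 + δ)⁻¹ * φ y) x
        = (1 + δ)⁻¹ * ∫ x, w x * deriv φ x := by
      rw [← integral_const_mul]
      refine integral_congr_ae (.of_forall fun x => ?_)
      simp only
      rw [deriv_const_mul _ (h1.differentiable (by simp) x)]; ring
    rw [e1, ENNReal.ofReal_le_iff_le_toReal htv, inv_mul_le_iff₀ (by positivity)] at htest
    have e2 : ∫ x, w x * r' x = (∫ x, w x * deriv φ x) + ∫ x, w x * (r' x - deriv φ x) := by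
      rw [← integral_add (hw.integrable_mul_two hφ.memLp_deriv)
        (hw.integrable_mul_two hd.memLp_deriv)]
      exact integral_congr_ae (.of_forall fun x => by simp only; ring)
    have e3 : ∫ x, w x * (r' x - deriv φ x) ≤ δ * √(∫ x, w x ^ 2) := by
      refine abs_le_of_sq_le_sq' ?_ (by positivity) |>.2
      rw [mul_pow, Real.sq_sqrt (integral_nonneg fun _ => sq_nonneg _), mul_comm]
      refine (integral_mul_sq_le hw hd.memLp_deriv).trans ?_
      exact mul_le_mul_of_nonneg_left (by linarith) (integral_nonneg fun _ => sq_nonneg _)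
    rw [e2]
    exact add_le_add htest e3
  have hl : Tendsto (fun δ : ℝ => (1 + δ) * V + δ * √(∫ x, w x ^ 2)) (𝓝[>] 0)
      (𝓝 ((1 + 0) * V + 0 * √(∫ x, w x ^ 2))) :=
    (Continuous.tendsto (by fun_prop) 0).mono_left nhdsWithin_le_nhds
  have := ge_of_tendsto hl (eventually_mem_nhdsWithin.mono fun δ hδ => main δ hδ)
  simpa using this

/-! ### Slices of functions on the strip -/

theorem stripMeasure_eq_prod (T : ℝ) :
    stripMeasure T = (volume.restrict (Ioo 0 T)).prod (volume : Measure ℝ) := by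
  rw [stripMeasure, strip, Measure.volume_eq_prod, ← Measure.prod_restrict, Measure.restrict_univ]

theorem integral_strip {T : ℝ} {f : ℝ × ℝ → ℝ} (hf : Integrable f (stripMeasure T)) :
    ∫ p in strip T, f p = ∫ t in Ioo 0 T, ∫ x, f (t, x) := by
  change ∫ p, f p ∂(stripMeasure T) = _
  rw [stripMeasure_eq_prod] at hf ⊢
  exact integral_prod f hf

theorem ae_ae_of_ae_strip {T : ℝ} {P : ℝ × ℝ → Prop} (h : ∀ᵐ p ∂(stripMeasure T), P p) :
    ∀ᵐ t ∂(volume.restrict (Ioo 0 T)), ∀ᵐ x, P (t, x) := by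
  rw [stripMeasure_eq_prod] at h
  exact Measure.ae_ae_of_ae_prod h

theorem memLp_slice {T : ℝ} {v : ℝ × ℝ → ℝ} (hv : MemLp v 2 (stripMeasure T)) :
    ∀ᵐ t ∂(volume.restrict (Ioo 0 T)), MemLp (fun x => v (t, x)) 2 := by
  have h1 := hv.integrable_sq
  have h2 := hv.aestronglyMeasurable
  rw [stripMeasure_eq_prod] at h1 h2
  filter_upwards [h1.prod_right_ae, h2.prodMk_left] with t h3 h4
  exact (memLp_two_iff_integrable_sq h4).2 h3

theorem memLp_comp_snd {T : ℝ} {β : ℝ → ℝ} (hβ : MemLp β 2) :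
    MemLp (fun p : ℝ × ℝ => β p.2) 2 (stripMeasure T) := by
  rw [stripMeasure_eq_prod]
  exact hβ.comp_snd _

theorem memLp_and_integral_sq_le_of_eLpNorm_le {f : ℝ → ℝ} {C : ℝ≥0} (hf : AEStronglyMeasurable f)
    (h : eLpNorm f 2 volume ≤ C) : MemLp f 2 ∧ ∫ x, f x ^ 2 ≤ (C : ℝ) ^ 2 := by
  have hm : MemLp f 2 := ⟨hf, h.trans_lt ENNReal.coe_lt_top⟩
  refine ⟨hm, ?_⟩
  have h1 : ‖hm.toLp f‖ ^ 2 = ∫ x, f x ^ 2 := by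
    rw [← real_inner_self_eq_norm_sq, L2.inner_def]
    refine integral_congr_ae ?_
    filter_upwards [hm.coeFn_toLp] with x e1
    rw [e1]; simp [pow_two]
  rw [← h1, Lp.norm_toLp]
  exact pow_le_pow_left₀ ENNReal.toReal_nonneg (ENNReal.toReal_le_coe_of_le_coe h) 2

theorem MemLinftyL2.integral_sq_le {T : ℝ} {v : ℝ × ℝ → ℝ} (h : MemLinftyL2 T v) :
    ∃ C : ℝ, 0 ≤ C ∧ ∀ᵐ t ∂(volume.restrict (Ioo 0 T)),
      MemLp (fun x => v (t, x)) 2 ∧ ∫ x, v (t, x) ^ 2 ≤ C := by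
  obtain ⟨h1, C, hC⟩ := h
  rw [stripMeasure_eq_prod] at h1
  refine ⟨(C : ℝ) ^ 2, by positivity, ?_⟩
  filter_upwards [hC, h1.prodMk_left] with t h2 h3
  exact memLp_and_integral_sq_le_of_eLpNorm_le h3 h2

theorem memLp_strip_of_ae_slice {T C : ℝ} {v : ℝ × ℝ → ℝ}
    (h : AEStronglyMeasurable v (stripMeasure T))
    (hC : ∀ᵐ t ∂(volume.restrict (Ioo 0 T)),
      MemLp (fun x => v (t, x)) 2 ∧ ∫ x, v (t, x) ^ 2 ≤ C) :
    MemLp v 2 (stripMeasure T) := by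
  rw [memLp_two_iff_integrable_sq h]
  have h2 : AEStronglyMeasurable (fun p => v p ^ 2) (stripMeasure T) := h.pow 2
  rw [stripMeasure_eq_prod] at h2 ⊢
  rw [integrable_prod_iff h2]
  refine ⟨hC.mono fun t ht => ht.1.integrable_sq, ?_⟩
  refine Integrable.of_bound (C := C) h2.norm.integral_prod_right' ?_
  filter_upwards [hC] with t ht
  rw [Real.norm_of_nonneg (integral_nonneg fun _ => norm_nonneg _)]
  simpa using ht.2

theorem MemLinftyL2.memLp {T : ℝ} {v : ℝ × ℝ → ℝ} (h : MemLinftyL2 T v) :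
    MemLp v 2 (stripMeasure T) :=
  let ⟨_, _, hC⟩ := h.integral_sq_le
  memLp_strip_of_ae_slice h.1 hC

theorem dx_eq_deriv {φ : ℝ × ℝ → ℝ} {t x : ℝ} (h : DifferentiableAt ℝ φ (t, x)) :
    dx φ (t, x) = deriv (fun y => φ (t, y)) x := by
  have h1 : HasDerivAt (fun y : ℝ => (t, y)) ((0 : ℝ), (1 : ℝ)) x :=
    (hasDerivAt_const x t).prodMk (hasDerivAt_id x)
  exact (h.hasFDerivAt.comp_hasDerivAt x h1).deriv.symm

theorem dt_eq_deriv {φ : ℝ × ℝ → ℝ} {t x : ℝ} (h : DifferentiableAt ℝ φ (t, x)) :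
    dt φ (t, x) = deriv (fun s => φ (s, x)) t := by
  have h1 : HasDerivAt (fun s : ℝ => (s, x)) ((1 : ℝ), (0 : ℝ)) t :=
    (hasDerivAt_id t).prodMk (hasDerivAt_const t x)
  exact (h.hasFDerivAt.comp_hasDerivAt t h1).deriv.symm

theorem tsupport_tensor_subset (α β : ℝ → ℝ) :
    tsupport (fun p : ℝ × ℝ => α p.1 * β p.2) ⊆ tsupport α ×ˢ tsupport β := by
  refine closure_minimal (fun p hp => ?_) ((isClosed_tsupport α).prod (isClosed_tsupport β))
  exact ⟨subset_tsupport α (left_ne_zero_of_mul hp), subset_tsupport β (right_ne_zero_of_mul hp)⟩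

theorem hasCompactSupport_tensor {α β : ℝ → ℝ} (hα : HasCompactSupport α)
    (hβ : HasCompactSupport β) : HasCompactSupport (fun p : ℝ × ℝ => α p.1 * β p.2) :=
  (hα.isCompact.prod hβ.isCompact).of_isClosed_subset (isClosed_tsupport _)
    (tsupport_tensor_subset α β)

theorem dx_tensor {α β : ℝ → ℝ} (hα : Differentiable ℝ α) (hβ : Differentiable ℝ β) (p : ℝ × ℝ) :
    dx (fun p : ℝ × ℝ => α p.1 * β p.2) p = α p.1 * deriv β p.2 := by
  rw [show p = (p.1, p.2) from rfl, dx_eq_deriv (by fun_prop)]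
  exact deriv_const_mul (α p.1) (hβ p.2)

theorem dt_tensor {α β : ℝ → ℝ} (hα : Differentiable ℝ α) (hβ : Differentiable ℝ β) (p : ℝ × ℝ) :
    dt (fun p : ℝ × ℝ => α p.1 * β p.2) p = deriv α p.1 * β p.2 := by
  rw [show p = (p.1, p.2) from rfl, dt_eq_deriv (by fun_prop)]
  exact deriv_mul_const (hα p.1) (β p.2)

theorem isTest_tensor {T : ℝ} {α β : ℝ → ℝ} (hα : ContDiff ℝ ∞ α) (hαc : HasCompactSupport α)
    (hαT : tsupport α ⊆ Ioo 0 T) (hβ : ContDiff ℝ ∞ β) (hβc : HasCompactSupport β) :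
    IsTest T (fun p : ℝ × ℝ => α p.1 * β p.2) where
  smooth := (hα.comp contDiff_fst).mul (hβ.comp contDiff_snd)
  compact := hasCompactSupport_tensor hαc hβc
  support := (tsupport_tensor_subset α β).trans (prod_mono hαT (subset_univ _))

/-- Almost every slice of a square integrable function with square integrable weak derivative `∂_x`
lies in `H¹(ℝ)`. -/
theorem HasWeakDx.ae_memH1 {T : ℝ} {v vx : ℝ × ℝ → ℝ} (h : HasWeakDx T v vx)
    (hv : MemLp v 2 (stripMeasure T)) (hvx : MemLp vx 2 (stripMeasure T)) :
    ∀ᵐ t ∂(volume.restrict (Ioo 0 T)), MemH1 (fun x => v (t, x)) (fun x => vx (t, x)) := by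
  have key : ∀ β : ℝ → ℝ, ContDiff ℝ ∞ β → HasCompactSupport β →
      ∀ᵐ t ∂(volume.restrict (Ioo 0 T)),
        (∫ x, vx (t, x) * β x) + ∫ x, v (t, x) * deriv β x = 0 := by
    intro β h1 h2
    have hβ := MemH1.of_contDiff h1 h2
    have i1 := hvx.integrable_mul_two (memLp_comp_snd hβ.memLp)
    have i2 := hv.integrable_mul_two (memLp_comp_snd hβ.memLp_deriv)
    have j1 := i1
    have j2 := i2
    rw [stripMeasure_eq_prod] at j1 j2
    have hI := j1.integral_prod_left.add j2.integral_prod_left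
    rw [ae_restrict_iff' measurableSet_Ioo]
    refine isOpen_Ioo.ae_eq_zero_of_integral_contDiff_smul_eq_zero
      (IntegrableOn.locallyIntegrableOn hI) fun α a1 a2 a3 => ?_
    have e := h.eq _ (isTest_tensor a1 a2 a3 h1 h2)
    obtain ⟨C, hC⟩ := a1.continuous.bounded_above_of_compact_support a2
    have hα : ∀ {f : ℝ × ℝ → ℝ}, Integrable f (stripMeasure T) →
        Integrable (fun p : ℝ × ℝ => α p.1 * f p) (stripMeasure T) := fun hf =>
      hf.bdd_mul (a1.continuous.comp continuous_fst).aestronglyMeasurable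
        (.of_forall fun p => hC p.1)
    have e1 : ∫ p in strip T, v p * dx (fun p : ℝ × ℝ => α p.1 * β p.2) p
        = ∫ t in Ioo 0 T, α t * ∫ x, v (t, x) * deriv β x := by
      rw [← integral_congr_ae (.of_forall fun p => by
        simp only; rw [dx_tensor (a1.differentiable (by simp)) (h1.differentiable (by simp))]
        ring : (fun p => α p.1 * (v p * deriv β p.2)) =ᵐ[stripMeasure T] _),
        integral_strip (hα i2)]
      simp only [integral_const_mul]
    have e2 : ∫ p in strip T, vx p * (α p.1 * β p.2)
        = ∫ t in Ioo 0 T, α t * ∫ x, vx (t, x) * β x := by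
      rw [← integral_congr_ae (.of_forall fun p => by
        simp only; ring : (fun p => α p.1 * (vx p * β p.2)) =ᵐ[stripMeasure T] _),
        integral_strip (hα i1)]
      simp only [integral_const_mul]
    rw [e1, e2] at e
    have hα1 : ∀ {f : ℝ → ℝ}, Integrable f (volume.restrict (Ioo 0 T)) →
        Integrable (fun t => α t * f t) (volume.restrict (Ioo 0 T)) := fun hf =>
      hf.bdd_mul a1.continuous.aestronglyMeasurable (.of_forall hC)
    have hout : ∀ t, t ∉ Ioo 0 T → α t = 0 := fun t ht => by
      by_contra h0; exact ht (a3 (subset_tsupport _ h0))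
    rw [← setIntegral_eq_integral_of_forall_compl_eq_zero (s := Ioo 0 T)
      (fun t ht => by rw [hout t ht, zero_smul])]
    simp only [smul_eq_mul, mul_add]
    rw [integral_add (hα1 j1.integral_prod_left) (hα1 j2.integral_prod_left), e]
    ring
  obtain ⟨D, hD, hD'⟩ := exists_countable_test
  filter_upwards [memLp_slice hv, memLp_slice hvx,
    ae_all_iff.2 fun n => key (D n) (hD n).1 (hD n).2] with t h1 h2 h3
  exact ⟨h1, h2, fun φ k1 k2 => by linarith [hD' _ _ h2 h1 h3 φ k1 k2]⟩

/-- The converse of `HasWeakDx.ae_memH1`. -/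
theorem HasWeakDx.of_ae_memH1 {T : ℝ} {v vx : ℝ × ℝ → ℝ}
    (hv : MemLp v 2 (stripMeasure T)) (hvx : MemLp vx 2 (stripMeasure T))
    (h : ∀ᵐ t ∂(volume.restrict (Ioo 0 T)), MemH1 (fun x => v (t, x)) (fun x => vx (t, x))) :
    HasWeakDx T v vx := by
  refine ⟨locallyIntegrableOn_of_locallyIntegrable_restrict (hv.locallyIntegrable (by norm_num)),
    locallyIntegrableOn_of_locallyIntegrable_restrict (hvx.locallyIntegrable (by norm_num)),
    fun φ hφ => ?_⟩
  have hdx : Continuous (dx φ) :=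
    (hφ.smooth.continuous_fderiv (by simp)).clm_apply continuous_const
  have hdxc : HasCompactSupport (dx φ) :=
    (hφ.compact.fderiv ℝ).comp_left (g := fun L : ℝ × ℝ →L[ℝ] ℝ => L (0, 1)) rfl
  rw [integral_strip (hv.integrable_mul_two (hdx.memLp_of_hasCompactSupport hdxc)),
    integral_strip (hvx.integrable_mul_two hφ.memLp), ← integral_neg]
  refine integral_congr_ae (h.mono fun t ht => ?_)
  have hs : ContDiff ℝ ∞ (fun x => φ (t, x)) := hφ.smooth.comp (contDiff_prodMk_right t)
  have hc : HasCompactSupport (fun x => φ (t, x)) :=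
    HasCompactSupport.of_support_subset_isCompact (hφ.compact.isCompact.image continuous_snd)
      fun x hx => ⟨(t, x), subset_tsupport φ hx, rfl⟩
  simp only
  rw [← ht.eq _ hs hc]
  exact integral_congr_ae (.of_forall fun x => by
    simp only; rw [dx_eq_deriv (hφ.smooth.differentiable (by simp) _)])

/-! ### The regularised sign and the subdifferential of `Ψ` at the origin -/

/-- The regularised sign `p / √(p² + ε²)`, the derivative of `regAbs ε`. -/
noncomputable def regSign (ε p : ℝ) : ℝ := p / √(p ^ 2 + ε ^ 2)

/-- The derivative of `regSign ε`. -/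
noncomputable def regSignDeriv (ε p : ℝ) : ℝ := ε ^ 2 / √(p ^ 2 + ε ^ 2) ^ 3

/-- The regularised absolute value, normalised to vanish at the origin. -/
noncomputable def regAbs (ε p : ℝ) : ℝ := √(p ^ 2 + ε ^ 2) - ε

/-- The primitive of `p * regSignDeriv ε p` that vanishes at the origin. -/
noncomputable def regFlux (ε p : ℝ) : ℝ := ε - ε ^ 2 / √(p ^ 2 + ε ^ 2)

theorem sqrt_reg_pos {ε : ℝ} (hε : 0 < ε) (p : ℝ) : 0 < √(p ^ 2 + ε ^ 2) :=
  Real.sqrt_pos.2 (by positivity)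

theorem le_sqrt_reg (ε p : ℝ) : ε ≤ √(p ^ 2 + ε ^ 2) :=
  Real.le_sqrt_of_sq_le (by nlinarith [sq_nonneg p])

theorem abs_le_sqrt_reg (ε p : ℝ) : |p| ≤ √(p ^ 2 + ε ^ 2) :=
  Real.abs_le_sqrt (by nlinarith [sq_nonneg ε])

theorem hasDerivAt_sqrt_reg {ε : ℝ} (hε : 0 < ε) (p : ℝ) :
    HasDerivAt (fun p : ℝ => √(p ^ 2 + ε ^ 2)) (p / √(p ^ 2 + ε ^ 2)) p := by
  have h := ((hasDerivAt_pow 2 p).add_const (ε ^ 2)).sqrt (by positivity)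
  convert h using 1
  simp only [Nat.cast_ofNat, Nat.add_one_sub_one, pow_one]
  field_simp

theorem hasDerivAt_regSign {ε : ℝ} (hε : 0 < ε) (p : ℝ) :
    HasDerivAt (regSign ε) (regSignDeriv ε p) p := by
  have hs := sqrt_reg_pos hε p
  refine ((hasDerivAt_id p).fun_div (hasDerivAt_sqrt_reg hε p) hs.ne').congr_deriv ?_
  have h2 : √(p ^ 2 + ε ^ 2) ^ 2 = p ^ 2 + ε ^ 2 := Real.sq_sqrt (by positivity)
  unfold regSignDeriv
  simp only [id]
  field_simp
  rw [h2]; ring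

theorem hasDerivAt_regFlux {ε : ℝ} (hε : 0 < ε) (p : ℝ) :
    HasDerivAt (regFlux ε) (p * regSignDeriv ε p) p := by
  have hs := sqrt_reg_pos hε p
  refine (((hasDerivAt_const p (ε ^ 2)).fun_div (hasDerivAt_sqrt_reg hε p)
    hs.ne').const_sub ε).congr_deriv ?_
  unfold regSignDeriv
  field_simp
  ring

theorem continuous_regSignDeriv {ε : ℝ} (hε : 0 < ε) : Continuous (regSignDeriv ε) := by
  unfold regSignDeriv
  exact continuous_const.div (by fun_prop) fun p => (pow_pos (sqrt_reg_pos hε p) 3).ne'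

theorem regSignDeriv_nonneg (ε p : ℝ) : 0 ≤ regSignDeriv ε p := by
  unfold regSignDeriv; positivity

theorem regSignDeriv_le {ε : ℝ} (hε : 0 < ε) (p : ℝ) : regSignDeriv ε p ≤ ε⁻¹ := by
  have h1 := le_sqrt_reg ε p
  have h3 : ε ^ 3 ≤ √(p ^ 2 + ε ^ 2) ^ 3 := pow_le_pow_left₀ hε.le h1 3
  unfold regSignDeriv
  rw [div_le_iff₀ (pow_pos (sqrt_reg_pos hε p) 3), ← div_eq_inv_mul, le_div_iff₀ hε]
  linarith [show ε ^ 2 * ε = ε ^ 3 by ring]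

theorem abs_mul_regSignDeriv_le {ε : ℝ} (hε : 0 < ε) (p : ℝ) : |p * regSignDeriv ε p| ≤ 1 := by
  have h1 := le_sqrt_reg ε p
  have hs := sqrt_reg_pos hε p
  rw [abs_mul, abs_of_nonneg (regSignDeriv_nonneg ε p), regSignDeriv, mul_div_assoc',
    div_le_one (pow_pos hs 3), pow_succ' _ 2]
  exact mul_le_mul (abs_le_sqrt_reg ε p) (pow_le_pow_left₀ hε.le h1 2) (by positivity) hs.le

theorem abs_regSign_le {ε : ℝ} (hε : 0 < ε) (p : ℝ) : |regSign ε p| ≤ 1 := by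
  have hs := sqrt_reg_pos hε p
  rw [regSign, abs_div, abs_of_pos hs, div_le_one hs]
  exact abs_le_sqrt_reg ε p

theorem regSign_zero (ε : ℝ) : regSign ε 0 = 0 := by simp [regSign]

theorem regFlux_zero {ε : ℝ} (hε : 0 < ε) : regFlux ε 0 = 0 := by
  rw [regFlux, zero_pow two_ne_zero, zero_add, Real.sqrt_sq hε.le]
  field_simp; ring

theorem regAbs_nonneg (ε p : ℝ) : 0 ≤ regAbs ε p := sub_nonneg.2 (le_sqrt_reg ε p)

theorem regAbs_le_mul_regSign {ε : ℝ} (hε : 0 < ε) (p : ℝ) : regAbs ε p ≤ p * regSign ε p := by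
  have hs := sqrt_reg_pos hε p
  have h2 : √(p ^ 2 + ε ^ 2) ^ 2 = p ^ 2 + ε ^ 2 := Real.sq_sqrt (by positivity)
  rw [regAbs, regSign, mul_div_assoc', le_div_iff₀ hs]
  nlinarith [le_sqrt_reg ε p]

theorem regAbs_le_sq {ε : ℝ} (hε : 0 < ε) (p : ℝ) : regAbs ε p ≤ ε⁻¹ * p ^ 2 := by
  have hs := sqrt_reg_pos hε p
  have h2 : √(p ^ 2 + ε ^ 2) ^ 2 = p ^ 2 + ε ^ 2 := Real.sq_sqrt (by positivity)
  rw [regAbs, ← div_eq_inv_mul, le_div_iff₀ hε]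
  nlinarith [le_sqrt_reg ε p]

theorem abs_mul_regFlux_le {ε : ℝ} (hε : 0 < ε) (p : ℝ) : |p * regFlux ε p| ≤ ε * regAbs ε p := by
  have hs := sqrt_reg_pos hε p
  have e : regFlux ε p = ε * regAbs ε p / √(p ^ 2 + ε ^ 2) := by
    unfold regFlux regAbs; field_simp
  have h0 := mul_nonneg hε.le (regAbs_nonneg ε p)
  rw [e, mul_div_assoc', abs_div, abs_of_pos hs, div_le_iff₀ hs, abs_mul,
    abs_of_nonneg h0, mul_comm]
  exact mul_le_mul_of_nonneg_left (abs_le_sqrt_reg ε p) h0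

/-- Convexity of `regAbs ε`, with its subgradient `regSign ε`. -/
theorem regAbs_sub_le {ε : ℝ} (hε : 0 < ε) (p q : ℝ) :
    regAbs ε p - regAbs ε q ≤ regSign ε p * (p - q) := by
  have hs := sqrt_reg_pos hε p
  have hq := sqrt_reg_pos hε q
  have h2 : √(p ^ 2 + ε ^ 2) ^ 2 = p ^ 2 + ε ^ 2 := Real.sq_sqrt (by positivity)
  have h3 : √(q ^ 2 + ε ^ 2) ^ 2 = q ^ 2 + ε ^ 2 := Real.sq_sqrt (by positivity)
  have h4 : p * q + ε ^ 2 ≤ √(p ^ 2 + ε ^ 2) * √(q ^ 2 + ε ^ 2) := by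
    refine abs_le_of_sq_le_sq' ?_ (by positivity) |>.2
    rw [mul_pow, h2, h3]
    nlinarith [mul_nonneg (sq_nonneg ε) (sq_nonneg (p - q))]
  rw [regAbs, regAbs, regSign, div_mul_eq_mul_div, le_div_iff₀ hs]
  nlinarith

theorem stress_eq (ε : ℝ) (ux : ℝ × ℝ → ℝ) (p : ℝ × ℝ) : stress ε ux p = regSign ε (ux p) := by
  rw [stress, regSign, sq_abs]

/-- The derivative `∂_x R^ε` of the regularised stress by the chain rule, for `ux = ∂_x u` and
`uxx = ∂_x² u`. -/
noncomputable def stressDx (ε : ℝ) (ux uxx : ℝ × ℝ → ℝ) (p : ℝ × ℝ) : ℝ :=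
  regSignDeriv ε (ux p) * uxx p

theorem MemH1.regSign {ε : ℝ} (hε : 0 < ε) {a b : ℝ → ℝ} (h : MemH1 a b) :
    MemH1 (fun x => regSign ε (a x)) (fun x => regSignDeriv ε (a x) * b x) :=
  h.comp (C := ⟨ε⁻¹, by positivity⟩) (hasDerivAt_regSign hε) (continuous_regSignDeriv hε)
    (regSign_zero ε) fun x => by
      rw [abs_of_nonneg (regSignDeriv_nonneg ε x)]; exact regSignDeriv_le hε x

theorem MemH1.regFlux {ε : ℝ} (hε : 0 < ε) {a b : ℝ → ℝ} (h : MemH1 a b) :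
    MemH1 (fun x => regFlux ε (a x)) (fun x => a x * regSignDeriv ε (a x) * b x) :=
  h.comp (C := 1) (hasDerivAt_regFlux hε) (continuous_id.mul (continuous_regSignDeriv hε))
    (regFlux_zero hε) fun x => by
      rw [NNReal.coe_one]; exact abs_mul_regSignDeriv_le hε x

theorem MemH1.neg {a b : ℝ → ℝ} (h : MemH1 a b) : MemH1 (fun x => -a x) (fun x => -b x) :=
  ⟨h.memLp.neg, h.memLp_deriv.neg, fun φ h1 h2 => by
    simp only [neg_mul, integral_neg, h.eq φ h1 h2]⟩

theorem memLp_stress {α : Type*} [MeasurableSpace α] {μ : Measure α} {ε : ℝ} (hε : 0 < ε)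
    {v : α → ℝ} (hv : MemLp v 2 μ) : MemLp (fun p => regSign ε (v p)) 2 μ := by
  have hc : Continuous (PlasticBurgers.regSign ε) :=
    continuous_iff_continuousAt.2 fun p => (hasDerivAt_regSign hε p).continuousAt
  refine hv.of_le_mul (c := ε⁻¹) (hc.comp_aestronglyMeasurable hv.aestronglyMeasurable)
    (.of_forall fun p => ?_)
  rw [Real.norm_eq_abs, Real.norm_eq_abs, PlasticBurgers.regSign, abs_div,
    abs_of_pos (sqrt_reg_pos hε _), div_eq_inv_mul]
  exact mul_le_mul_of_nonneg_right (inv_anti₀ hε (le_sqrt_reg ε _)) (abs_nonneg _)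

theorem memLp_stressDx {T ε : ℝ} (hε : 0 < ε) {ux uxx : ℝ × ℝ → ℝ}
    (h1 : MemLp ux 2 (stripMeasure T)) (h2 : MemLp uxx 2 (stripMeasure T)) :
    MemLp (stressDx ε ux uxx) 2 (stripMeasure T) := by
  refine h2.of_le_mul (c := ε⁻¹) (((continuous_regSignDeriv hε).comp_aestronglyMeasurable
    h1.aestronglyMeasurable).mul h2.aestronglyMeasurable) (.of_forall fun p => ?_)
  rw [stressDx, norm_mul, Real.norm_of_nonneg (regSignDeriv_nonneg ε _)]
  exact mul_le_mul_of_nonneg_right (regSignDeriv_le hε _) (norm_nonneg _)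

theorem HasWeakDx.stress {T ε : ℝ} (hε : 0 < ε) {ux uxx : ℝ × ℝ → ℝ} (h : HasWeakDx T ux uxx)
    (h1 : MemLp ux 2 (stripMeasure T)) (h2 : MemLp uxx 2 (stripMeasure T)) :
    HasWeakDx T (stress ε ux) (stressDx ε ux uxx) := by
  rw [show PlasticBurgers.stress ε ux = _ from funext (stress_eq ε ux)]
  exact .of_ae_memH1 (memLp_stress hε h1) (memLp_stressDx hε h1 h2)
    ((h.ae_memH1 h1 h2).mono fun t ht => ht.regSign hε)

theorem HasWeakDx.congr_right {T : ℝ} {f g g' : ℝ × ℝ → ℝ} (h : HasWeakDx T f g)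
    (e : g =ᵐ[stripMeasure T] g') (hg' : MemLp g' 2 (stripMeasure T)) : HasWeakDx T f g' :=
  ⟨h.locInt_left, locallyIntegrableOn_of_locallyIntegrable_restrict
    (hg'.locallyIntegrable (by norm_num)), fun φ hφ => by
    rw [h.eq φ hφ]
    exact congrArg _ (integral_congr_ae (e.mono fun p hp => by simp only [hp]))⟩

theorem totalVariation_eq_zero {f : ℝ → ℝ} (h : f =ᵐ[volume] 0) : totalVariation f = 0 := by
  rw [totalVariation]
  simp only [ENNReal.iSup_eq_zero]
  intro φ _
  rw [integral_congr_ae (h.mono fun x hx => by simp [hx] :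
    (fun x => f x * deriv φ x) =ᵐ[volume] fun _ => 0)]
  simp

theorem zero_mem_Y (T : ℝ) : (0 : X T) ∈ Y T ∧ Psi T 0 = 0 := by
  have h : ∀ᵐ t ∂(volume.restrict (Ioo 0 T)), (fun x => (0 : X T) (t, x)) =ᵐ[volume] 0 :=
    ae_ae_of_ae_strip (P := fun p => (0 : X T) p = 0) (Lp.coeFn_zero ℝ 2 (stripMeasure T))
  have hY : (0 : X T) ∈ Y T := by
    refine ⟨h.mono fun t ht => ⟨(integrable_zero _ _ _).congr ht.symm, ?_⟩, ?_⟩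
    · rw [totalVariation_eq_zero ht]; exact ENNReal.zero_lt_top
    · rw [lintegral_congr_ae (h.mono fun t ht => by
        simp only [bvNorm]
        rw [totalVariation_eq_zero ht, eLpNorm_congr_ae ht, eLpNorm_zero, add_zero])]
      simp
  refine ⟨hY, ?_⟩
  rw [Psi, if_pos hY, lintegral_congr_ae (h.mono fun t ht => totalVariation_eq_zero ht)]
  simp

theorem Psi_lt_top {T : ℝ} {w : X T} (hw : w ∈ Y T) : Psi T w < ⊤ := by
  rw [Psi, if_pos hw]
  exact (lintegral_mono fun t => le_add_self).trans_lt hw.2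

/-- Since `Ψ(0) = 0` and `Ψ = ∞` outside of `Y`, only the inequality on `Y` has to be checked. -/
theorem mem_subdifferential_Psi_zero {T : ℝ} {η : StrongDual ℝ (X T)}
    (h : ∀ w ∈ Y T, η w ≤ (Psi T w).toReal) : η ∈ subdifferential (Psi T) 0 := by
  refine ⟨by rw [(zero_mem_Y T).2]; exact ENNReal.zero_lt_top, fun w => ?_⟩
  rw [(zero_mem_Y T).2, sub_zero, EReal.coe_ennreal_zero, zero_add]
  by_cases hw : w ∈ Y T
  · rw [← ENNReal.ofReal_toReal (Psi_lt_top hw).ne, EReal.coe_ennreal_ofReal,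
      max_eq_left ENNReal.toReal_nonneg]
    exact EReal.coe_le_coe_iff.2 (h w hw)
  · rw [Psi, if_neg hw]
    simp

theorem functional_apply {T : ℝ} (g w : X T) : functional g w = ∫ p in strip T, g p * w p := by
  change inner ℝ g w = _
  rw [L2.inner_def]
  exact integral_congr_ae (.of_forall fun p => by simp [mul_comm])

/-- No measurability of `V` is assumed, so that this applies to the total variation of slices. -/
theorem integral_le_toReal_lintegral {α : Type*} [MeasurableSpace α] {μ : Measure α} {k : α → ℝ}
    {V : α → ℝ≥0∞} (h : ∀ᵐ t ∂μ, ENNReal.ofReal (k t) ≤ V t) (hV : ∫⁻ t, V t ∂μ ≠ ⊤) :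
    ∫ t, k t ∂μ ≤ (∫⁻ t, V t ∂μ).toReal := by
  by_cases hk : Integrable k μ
  · rw [integral_eq_lintegral_pos_part_sub_lintegral_neg_part hk]
    have := ENNReal.toReal_mono hV (lintegral_mono_ae h)
    have h2 : 0 ≤ (∫⁻ t, ENNReal.ofReal (-k t) ∂μ).toReal := ENNReal.toReal_nonneg
    linarith
  · rw [integral_undef hk]; exact ENNReal.toReal_nonneg

/-- If `|f| ≤ 1`, then `-∂_x f` is dominated by `Ψ` on `Y`. -/
theorem functional_neg_weakDx_le {T : ℝ} {f : ℝ × ℝ → ℝ} {g : X T} (h : HasWeakDx T f g)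
    (hf : MemLp f 2 (stripMeasure T)) (hb : ∀ p, |f p| ≤ 1) {w : X T} (hw : w ∈ Y T) :
    functional (-g) w ≤ (Psi T w).toReal := by
  have hg := Lp.memLp g
  have hwL := Lp.memLp w
  have e : functional (-g) w = ∫ t in Ioo 0 T, ∫ x, w (t, x) * -g (t, x) := by
    rw [functional_apply, ← integral_strip (f := fun p => w p * -g p)
      (hwL.integrable_mul_two hg.neg)]
    refine integral_congr_ae ?_
    filter_upwards [Lp.coeFn_neg g] with p hp
    rw [hp]; exact mul_comm _ _
  have ht := Psi_lt_top hw
  rw [Psi, if_pos hw] at ht ⊢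
  rw [e]
  refine integral_le_toReal_lintegral ?_ ht.ne
  filter_upwards [h.ae_memH1 hf hg, memLp_slice hwL, hw.1] with t h1 h2 h3
  refine ENNReal.ofReal_le_of_le_toReal ?_
  exact h1.neg.integral_mul_deriv_le_totalVariation (fun x => by rw [abs_neg]; exact hb _) h2
    h3.2.ne

theorem HasWeakDx.stress_toLp {T ε : ℝ} (hε : 0 < ε) {ux uxx : ℝ × ℝ → ℝ}
    (h : HasWeakDx T ux uxx) (h1 : MemLp ux 2 (stripMeasure T))
    (h2 : MemLp uxx 2 (stripMeasure T)) :
    HasWeakDx T (PlasticBurgers.stress ε ux) ((memLp_stressDx hε h1 h2).toLp _) :=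
  (h.stress hε h1 h2).congr_right (memLp_stressDx hε h1 h2).coeFn_toLp.symm (Lp.memLp _)

theorem functional_neg_stressDx_le {T ε : ℝ} (hε : 0 < ε) {ux uxx : ℝ × ℝ → ℝ}
    (h : HasWeakDx T ux uxx) (h1 : MemLp ux 2 (stripMeasure T))
    (h2 : MemLp uxx 2 (stripMeasure T)) {w : X T} (hw : w ∈ Y T) :
    functional (-((memLp_stressDx hε h1 h2).toLp _)) w ≤ (Psi T w).toReal := by
  refine functional_neg_weakDx_le (h.stress_toLp hε h1 h2) ?_ (fun p => ?_) hw
  · rw [show PlasticBurgers.stress ε ux = _ from funext (stress_eq ε ux)]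
    exact memLp_stress hε h1
  · rw [stress_eq]; exact abs_regSign_le hε _

/-! ### The integrated equation -/

/-- The weak form of `U' = q` on `(0,T)` with initial value `c`, tested with functions that need not
vanish at `t = 0`, in integrated form. -/
theorem ae_eq_add_integral_of_weak {T c : ℝ} (hT : 0 < T) {U q : ℝ → ℝ}
    (hU : IntegrableOn U (Ioo 0 T)) (hq : IntegrableOn q (Ioo 0 T))
    (h : ∀ α : ℝ → ℝ, ContDiff ℝ ∞ α → HasCompactSupport α → tsupport α ⊆ Iio T →
      (∫ t in Ioo 0 T, (deriv α t * U t + α t * q t)) + α 0 * c = 0) :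
    ∀ᵐ t ∂(volume.restrict (Ioo 0 T)), U t = c + ∫ s in Ioo 0 t, q s := by
  let q' : ℝ → ℝ := (Ioo 0 T).indicator q
  have hq' : Integrable q' := (integrable_indicator_iff measurableSet_Ioo).2 hq
  let P : ℝ → ℝ := fun t => 0 + ∫ s in 0..t, q' s
  have hP : IsPrimitive P q' := .of_integral hq'.locallyIntegrable 0 0
  have hP0 : P 0 = 0 := by simp [P]
  have key : ∀ᵐ t, t ∈ Ioo 0 T → U t - (P t + c) = 0 := by
    have hi : IntegrableOn (fun t => P t + c) (Ioo 0 T) :=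
      ((hP.continuous.add continuous_const).integrableOn_Icc).mono_set Ioo_subset_Icc_self
    refine isOpen_Ioo.ae_eq_zero_of_integral_contDiff_smul_eq_zero
      (IntegrableOn.locallyIntegrableOn (hU.sub hi)) fun γ g1 g2 g3 => ?_
    have hγ0 : ∀ t, t ∉ Ioo 0 T → γ t = 0 := fun t ht => by
      by_contra h0; exact ht (g3 (subset_tsupport _ h0))
    obtain ⟨C, hC⟩ := g1.continuous.bounded_above_of_compact_support g2
    -- an upper bound of the support of `γ` below `T`
    obtain ⟨T', hT', hγT'⟩ : ∃ T' < T, ∀ t, T' < t → γ t = 0 := by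
      rcases (tsupport γ).eq_empty_or_nonempty with he | hne
      · exact ⟨0, hT, fun t _ => image_eq_zero_of_notMem_tsupport (by simp [he])⟩
      · obtain ⟨m, hm, hmax⟩ := g2.isCompact.exists_isMaxOn hne continuousOn_id
        exact ⟨m, (g3 hm).2, fun t ht => image_eq_zero_of_notMem_tsupport fun hts =>
          absurd (hmax hts) (not_le.2 ht)⟩
    -- tested is the antiderivative of `γ` that vanishes near `T`, cut off away from `[0, T]`
    let α₀ : ℝ → ℝ := fun t => ∫ s in T..t, γ s
    have hd : ∀ x, HasDerivAt α₀ (γ x) x := fun x =>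
      intervalIntegral.integral_hasDerivAt_right (g1.continuous.intervalIntegrable _ _)
        g1.continuous.aestronglyMeasurable.stronglyMeasurableAtFilter g1.continuous.continuousAt
    have hd' : deriv α₀ = γ := funext fun x => (hd x).deriv
    have hα₀ : ContDiff ℝ ∞ α₀ := by
      rw [contDiff_infty_iff_deriv]
      exact ⟨fun x => (hd x).differentiableAt, hd'.symm ▸ g1⟩
    have hα₀s : ∀ t, T' < t → α₀ t = 0 := fun t ht =>
      intervalIntegral.integral_zero_ae (.of_forall fun s hs => hγT' s
        ((lt_min hT' ht).trans hs.1))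
    let χ : ContDiffBump (0 : ℝ) := ⟨T + 1, T + 2, by linarith, by linarith⟩
    have hχ1 : ∀ t ∈ Icc 0 T, ∀ᶠ s in 𝓝 t, χ s = 1 := fun t ht =>
      χ.eventuallyEq_one_of_mem_ball (by
        change t ∈ Metric.ball (0 : ℝ) (T + 1)
        rw [Metric.mem_ball, Real.dist_eq, sub_zero, abs_of_nonneg ht.1]; linarith [ht.2])
    have hα := h (fun t => χ t * α₀ t) (χ.contDiff.mul hα₀) χ.hasCompactSupport.mul_right
      (by
        refine (closure_minimal (fun t ht => ?_) isClosed_Iic).trans (Iic_subset_Iio.2 hT')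
        by_contra hlt
        exact ht (by simp only; rw [hα₀s t (not_le.1 hlt), mul_zero]))
    have hαd : ∀ t ∈ Ioo 0 T, deriv (fun t => χ t * α₀ t) t = γ t := fun t ht => by
      rw [← hd']
      refine Filter.EventuallyEq.deriv_eq ?_
      filter_upwards [hχ1 t (Ioo_subset_Icc_self ht)] with s hs
      rw [hs, one_mul]
    have hα1 : ∀ t ∈ Icc 0 T, χ t * α₀ t = α₀ t := fun t ht => by
      rw [(hχ1 t ht).self_of_nhds, one_mul]
    rw [hα1 0 ⟨le_rfl, hT.le⟩, setIntegral_congr_fun (g := fun t => γ t * U t + α₀ t * q' t)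
      measurableSet_Ioo (fun t ht => by
        simp only [q']
        rw [hαd t ht, hα1 t (Ioo_subset_Icc_self ht), indicator_of_mem ht])] at hα
    have hα₀p : IsPrimitive α₀ γ := hd' ▸ IsPrimitive.of_contDiff (hα₀.of_le (by simp))
    have e0 := (hα₀p.mul hP).sub_eq 0 T
    have e1 : α₀ T = 0 := hα₀s T hT'
    rw [e1, hP0, zero_mul, mul_zero, sub_zero, intervalIntegral.integral_of_le hT.le,
      integral_Ioc_eq_integral_Ioo] at e0
    have e2 : α₀ 0 = -∫ t in Ioo 0 T, γ t := by
      simp only [α₀]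
      rw [intervalIntegral.integral_symm, intervalIntegral.integral_of_le hT.le,
        integral_Ioc_eq_integral_Ioo]
    have hγU : ∀ {f : ℝ → ℝ}, IntegrableOn f (Ioo 0 T) →
        IntegrableOn (fun t => γ t * f t) (Ioo 0 T) := fun hf =>
      hf.bdd_mul g1.continuous.aestronglyMeasurable (.of_forall hC)
    have iP : IntegrableOn P (Ioo 0 T) :=
      hP.continuous.integrableOn_Icc.mono_set Ioo_subset_Icc_self
    have iα : IntegrableOn (fun t => α₀ t * q' t) (Ioo 0 T) := by
      have h0 : IntervalIntegrable (fun t => α₀ t * q' t) volume 0 T :=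
        (hP.intervalIntegrable 0 T).continuousOn_mul hα₀.continuous.continuousOn
      exact ((intervalIntegrable_iff_integrableOn_Ioc_of_le hT.le).1 h0).mono_set
        Ioo_subset_Ioc_self
    have iγ : IntegrableOn γ (Ioo 0 T) :=
      (g1.continuous.integrable_of_hasCompactSupport g2).integrableOn
    rw [integral_add (hγU hU) iα, e2] at hα
    rw [integral_add (hγU iP) iα] at e0
    rw [← setIntegral_eq_integral_of_forall_compl_eq_zero (s := Ioo 0 T)
      (fun t ht => by rw [hγ0 t ht, zero_smul])]
    have iPc : IntegrableOn (fun t => γ t * P t + γ t * c) (Ioo 0 T) :=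
      (hγU iP).add (iγ.mul_const c)
    have e3 : ∫ t in Ioo 0 T, γ t • (U t - (P t + c))
        = (∫ t in Ioo 0 T, γ t * U t)
          - ((∫ t in Ioo 0 T, γ t * P t) + (∫ t in Ioo 0 T, γ t) * c) := by
      rw [← integral_mul_const, ← integral_add (hγU iP) (iγ.mul_const c),
        ← integral_sub (hγU hU) iPc]
      exact integral_congr_ae (.of_forall fun t => by simp only [smul_eq_mul]; ring)
    rw [e3]
    linarith
  rw [ae_restrict_iff' measurableSet_Ioo]
  filter_upwards [key] with t ht htT
  have e : ∫ s in Ioo 0 t, q s = P t := by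
    simp only [P]
    rw [zero_add, intervalIntegral.integral_of_le htT.1.le, integral_Ioc_eq_integral_Ioo]
    exact setIntegral_congr_fun measurableSet_Ioo fun s hs => by
      simp only [q']
      rw [indicator_of_mem (show s ∈ Ioo 0 T from ⟨hs.1, hs.2.trans htT.2⟩)]
  rw [e]
  linarith [ht htT]

/-- Integration in `t` over a finite measure maps `L²` in `(t, x)` to `L²` in `x`. -/
theorem memLp_integral_left {μ : Measure ℝ} [IsFiniteMeasure μ] {Q : ℝ × ℝ → ℝ}
    (hQ : MemLp Q 2 (μ.prod (volume : Measure ℝ))) : MemLp (fun x => ∫ s, Q (s, x) ∂μ) 2 := by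
  have hm : AEStronglyMeasurable (fun x => ∫ s, Q (s, x) ∂μ) volume :=
    hQ.aestronglyMeasurable.prod_swap.integral_prod_right'
  rw [memLp_two_iff_integrable_sq hm]
  have hi := hQ.integrable_sq
  refine Integrable.mono' (hi.integral_prod_right.const_mul (μ.real univ)) (hm.pow 2) ?_
  have h1 := hi.prod_left_ae
  have h2 : ∀ᵐ x, AEStronglyMeasurable (fun s => Q (s, x)) μ :=
    hQ.aestronglyMeasurable.prod_swap.prodMk_left
  filter_upwards [h1, h2] with x h3 h4
  have h5 := integral_mul_sq_le (memLp_const (1 : ℝ)) ((memLp_two_iff_integrable_sq h4).2 h3)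
  rw [Real.norm_of_nonneg (sq_nonneg _)]
  simpa using h5

/-- If every test function in space annihilates almost every slice, then almost every slice
vanishes; the exceptional set of times may depend on the test function. -/
theorem ae_eq_zero_of_integral_test {T : ℝ} {D : ℝ × ℝ → ℝ}
    (hD : ∀ᵐ t ∂(volume.restrict (Ioo 0 T)), MemLp (fun x => D (t, x)) 2)
    (h : ∀ β : ℝ → ℝ, ContDiff ℝ ∞ β → HasCompactSupport β →
      ∀ᵐ t ∂(volume.restrict (Ioo 0 T)), ∫ x, D (t, x) * β x = 0) :
    ∀ᵐ t ∂(volume.restrict (Ioo 0 T)), ∀ᵐ x, D (t, x) = 0 := by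
  obtain ⟨B, hB, hB'⟩ := exists_countable_test
  filter_upwards [hD, ae_all_iff.2 fun n => h (B n) (hB n).1 (hB n).2] with t h1 h2
  refine ae_eq_zero_of_integral_contDiff_smul_eq_zero (h1.locallyIntegrable (by norm_num))
    fun φ k1 k2 => ?_
  have := hB' _ (fun _ => 0) h1 MemLp.zero (fun n => by simp [h2 n]) φ k1 k2
  simpa [mul_comm] using this

/-- The right-hand side of the equation `∂_t u = ∂_x R^ε + ε ∂_x² u - u ∂_x u`. -/
noncomputable def rhs (ε : ℝ) (u ux uxx : ℝ × ℝ → ℝ) (p : ℝ × ℝ) : ℝ :=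
  stressDx ε ux uxx p + ε * uxx p - u p * ux p

/-- The convective term is square integrable, because `u` is bounded by the embedding of `H¹(ℝ)`
into `L^∞(ℝ)`. -/
theorem memLp_mul_weakDx {T : ℝ} {u ux : ℝ × ℝ → ℝ} (h : HasWeakDx T u ux)
    (hu : MemLinftyL2 T u) (hux : MemLinftyL2 T ux) :
    MemLp (fun p => u p * ux p) 2 (stripMeasure T) := by
  obtain ⟨C, hC0, hC⟩ := hu.integral_sq_le
  obtain ⟨C', hC0', hC'⟩ := hux.integral_sq_le
  refine memLp_strip_of_ae_slice (C := (C + C') * C') (hu.1.mul hux.1) ?_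
  filter_upwards [h.ae_memH1 hu.memLp hux.memLp, hC, hC'] with t h1 h2 h3
  have hb : ∀ᵐ x, u (t, x) ^ 2 ≤ C + C' := by
    filter_upwards [h1.sq_le] with x hx
    refine hx.trans (le_trans ?_ (add_le_add h2.2 h3.2))
    rw [← integral_const_mul, ← integral_add h2.1.integrable_sq h3.1.integrable_sq]
    refine integral_mono ((h2.1.integrable_mul_two h3.1).abs.const_mul 2)
      (h2.1.integrable_sq.add h3.1.integrable_sq) fun y => ?_
    simp only [abs_mul]
    nlinarith [sq_nonneg (|u (t, y)| - |ux (t, y)|), sq_abs (u (t, y)), sq_abs (ux (t, y))]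
  have hm : MemLp (fun x => u (t, x) * ux (t, x)) 2 := by
    refine h3.1.of_le_mul (c := √(C + C'))
      (h2.1.aestronglyMeasurable.mul h3.1.aestronglyMeasurable) ?_
    filter_upwards [hb] with x hx
    rw [norm_mul]
    exact mul_le_mul_of_nonneg_right (Real.abs_le_sqrt hx) (norm_nonneg _)
  refine ⟨hm, ?_⟩
  refine le_trans ?_ (mul_le_mul_of_nonneg_left h3.2 (add_nonneg hC0 hC0'))
  rw [← integral_const_mul]
  refine integral_mono_ae hm.integrable_sq (h3.1.integrable_sq.const_mul _) ?_
  filter_upwards [hb] with x hx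
  simp only [mul_pow]
  exact mul_le_mul_of_nonneg_right hx (sq_nonneg _)

theorem memLp_rhs {T ε : ℝ} (hε : 0 < ε) {u ux uxx : ℝ × ℝ → ℝ} (h : HasWeakDx T u ux)
    (hu : MemLinftyL2 T u) (hux : MemLinftyL2 T ux) (huxx : MemLp uxx 2 (stripMeasure T)) :
    MemLp (rhs ε u ux uxx) 2 (stripMeasure T) :=
  ((memLp_stressDx hε hux.memLp huxx).add (huxx.const_mul ε)).sub (memLp_mul_weakDx h hu hux)

theorem integral_flux_mul_deriv {ε : ℝ} (hε : 0 < ε) {a b c β : ℝ → ℝ} (h1 : MemH1 a b)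
    (h2 : MemH1 b c) (hβ : ContDiff ℝ ∞ β) (hβc : HasCompactSupport β) :
    ∫ x, (a x ^ 2 / 2 - ε * b x - regSign ε (b x)) * deriv β x
      = ∫ x, (regSignDeriv ε (b x) * c x + ε * c x - a x * b x) * β x := by
  have hr := h2.regSign hε
  have hB := MemH1.of_contDiff hβ hβc
  obtain ⟨M, hM⟩ := hβ.continuous.bounded_above_of_compact_support hβc
  obtain ⟨M', hM'⟩ := (hβ.continuous_deriv (by simp)).bounded_above_of_compact_support hβc.deriv
  have i1 : Integrable (fun x => a x ^ 2 / 2 * deriv β x) :=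
    (h1.memLp.integrable_sq.div_const 2).mul_bdd (c := M')
      (hβ.continuous_deriv (by simp)).aestronglyMeasurable (.of_forall hM')
  have i2 : Integrable (fun x => a x * b x * β x) :=
    (h1.memLp.integrable_mul_two h2.memLp).mul_bdd (c := M)
      hβ.continuous.aestronglyMeasurable (.of_forall hM)
  have i3 := h2.memLp.integrable_mul_two hB.memLp_deriv
  have i4 := hr.memLp.integrable_mul_two hB.memLp_deriv
  have i5 := h2.memLp_deriv.integrable_mul_two hB.memLp
  have i6 := hr.memLp_deriv.integrable_mul_two hB.memLp
  have i7 : Integrable (fun x => a x ^ 2 / 2 * deriv β x - ε * (b x * deriv β x)) :=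
    i1.sub (i3.const_mul ε)
  have i8 : Integrable (fun x => regSignDeriv ε (b x) * c x * β x + ε * (c x * β x)) :=
    i6.add (i5.const_mul ε)
  have e1 : ∫ x, (a x ^ 2 / 2 - ε * b x - regSign ε (b x)) * deriv β x
      = (∫ x, a x ^ 2 / 2 * deriv β x) - ε * (∫ x, b x * deriv β x)
        - ∫ x, regSign ε (b x) * deriv β x := by
    rw [← integral_const_mul, ← integral_sub i1 (i3.const_mul ε),
      ← integral_sub i7 i4]
    exact integral_congr_ae (.of_forall fun x => by simp only; ring)
  have e2 : ∫ x, (regSignDeriv ε (b x) * c x + ε * c x - a x * b x) * β x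
      = (∫ x, regSignDeriv ε (b x) * c x * β x) + ε * (∫ x, c x * β x)
        - ∫ x, a x * b x * β x := by
    rw [← integral_const_mul, ← integral_add i6 (i5.const_mul ε),
      ← integral_sub i8 i2]
    exact integral_congr_ae (.of_forall fun x => by simp only; ring)
  rw [e1, e2, h1.integral_sq_mul_deriv (hβ.of_le (by simp)) hβc, h2.eq β hβ hβc, hr.eq β hβ hβc]
  ring

/-- The integrated equation, tested with `β` in space. -/
theorem IsViscoplasticSolution.integral_slice {T ε : ℝ} (hT : 0 < T) (hε : 0 < ε) {uin : ℝ → ℝ}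
    {u ux uxx : ℝ × ℝ → ℝ} (h : IsViscoplasticSolution ε uin u ux)
    (hu : MemLinftyL2 T u) (hux : MemLinftyL2 T ux) (huxx : MemLp uxx 2 (stripMeasure T))
    (hw : HasWeakDx T ux uxx) {β : ℝ → ℝ} (b1 : ContDiff ℝ ∞ β) (b2 : HasCompactSupport β) :
    ∀ᵐ t ∂(volume.restrict (Ioo 0 T)), ∫ x, u (t, x) * β x
      = (∫ x, uin x * β x) + ∫ s in Ioo 0 t, ∫ x, rhs ε u ux uxx (s, x) * β x := by
  have hwu := h.weakDx T hT
  have hB := MemH1.of_contDiff b1 b2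
  have hQ := memLp_rhs hε hwu hu hux huxx
  have i1 := hu.memLp.integrable_mul_two (memLp_comp_snd hB.memLp)
  have i2 := hQ.integrable_mul_two (memLp_comp_snd hB.memLp)
  have i3 : Integrable (fun p : ℝ × ℝ => (u p ^ 2 / 2 - ε * ux p - regSign ε (ux p)) * deriv β p.2)
      (stripMeasure T) := by
    obtain ⟨M', hM'⟩ := (b1.continuous_deriv (by simp)).bounded_above_of_compact_support b2.deriv
    have j1 : Integrable (fun p : ℝ × ℝ => u p ^ 2 / 2 * deriv β p.2) (stripMeasure T) :=
      (hu.memLp.integrable_sq.div_const 2).mul_bdd (c := M')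
        ((b1.continuous_deriv (by simp)).comp continuous_snd).aestronglyMeasurable
        (.of_forall fun p => hM' p.2)
    have j2 := ((hux.memLp.const_mul ε).add (memLp_stress hε hux.memLp)).integrable_mul_two
      (memLp_comp_snd hB.memLp_deriv)
    refine (j1.sub j2).congr (.of_forall fun p => ?_)
    simp only [Pi.sub_apply, Pi.add_apply]; ring
  have k1 := i1
  have k2 := i2
  rw [stripMeasure_eq_prod] at k1 k2
  refine ae_eq_add_integral_of_weak hT k1.integral_prod_left k2.integral_prod_left
    fun α a1 a2 a3 => ?_
  obtain ⟨C, hC⟩ := a1.continuous.bounded_above_of_compact_support a2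
  obtain ⟨C', hC'⟩ := (a1.continuous_deriv (by simp)).bounded_above_of_compact_support a2.deriv
  have i4 : Integrable (fun p : ℝ × ℝ => deriv α p.1 * (u p * β p.2)) (stripMeasure T) :=
    i1.bdd_mul ((a1.continuous_deriv (by simp)).comp continuous_fst).aestronglyMeasurable
      (.of_forall fun p => hC' p.1)
  have i5 : Integrable (fun p : ℝ × ℝ => α p.1 *
      ((u p ^ 2 / 2 - ε * ux p - regSign ε (ux p)) * deriv β p.2)) (stripMeasure T) :=
    i3.bdd_mul (a1.continuous.comp continuous_fst).aestronglyMeasurable (.of_forall fun p => hC p.1)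
  have i6 : Integrable (fun p : ℝ × ℝ => deriv α p.1 * (u p * β p.2) + α p.1 *
      ((u p ^ 2 / 2 - ε * ux p - regSign ε (ux p)) * deriv β p.2)) (stripMeasure T) := i4.add i5
  have e := h.weak_form (fun p => α p.1 * β p.2)
    (((a1.comp contDiff_fst).mul (b1.comp contDiff_snd)).of_le (by simp))
    (hasCompactSupport_tensor a2 b2)
  have hz : ∀ t, T ≤ t → α t = 0 ∧ deriv α t = 0 := fun t ht => by
    have hn : t ∉ tsupport α := fun h' => absurd (a3 h') (not_lt.2 ht)
    exact ⟨image_eq_zero_of_notMem_tsupport hn,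
      image_eq_zero_of_notMem_tsupport fun h' => hn (tsupport_deriv_subset h')⟩
  have e1 : ∫ p in Ioi (0 : ℝ) ×ˢ (univ : Set ℝ),
      (u p * dt (fun p => α p.1 * β p.2) p + ((u p) ^ 2 / 2 - ε * ux p - stress ε ux p)
        * dx (fun p => α p.1 * β p.2) p)
      = ∫ p in strip T, (deriv α p.1 * (u p * β p.2) + α p.1 *
      ((u p ^ 2 / 2 - ε * ux p - regSign ε (ux p)) * deriv β p.2)) := by
    rw [setIntegral_eq_of_subset_of_forall_sdiff_eq_zero (s := strip T)
      (measurableSet_Ioi.prod .univ) (prod_mono Ioo_subset_Ioi_self le_rfl)]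
    · refine integral_congr_ae (.of_forall fun p => ?_)
      simp only
      rw [dt_tensor (a1.differentiable (by simp)) (b1.differentiable (by simp)),
        dx_tensor (a1.differentiable (by simp)) (b1.differentiable (by simp)), stress_eq]
      ring
    · rintro p ⟨⟨hp1, -⟩, hp2⟩
      have hp : T ≤ p.1 := by
        by_contra hlt
        exact hp2 ⟨⟨hp1, not_le.1 hlt⟩, trivial⟩
      rw [dt_tensor (a1.differentiable (by simp)) (b1.differentiable (by simp)),
        dx_tensor (a1.differentiable (by simp)) (b1.differentiable (by simp)), (hz _ hp).1,
        (hz _ hp).2]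
      ring
  have e2 : ∫ x, uin x * (α 0 * β x) = α 0 * ∫ x, uin x * β x := by
    rw [← integral_const_mul]
    exact integral_congr_ae (.of_forall fun x => by simp only; ring)
  rw [e1, e2, integral_strip i6] at e
  refine Eq.trans (congrArg₂ _ ?_ rfl) e
  · have l4 := i4
    have l5 := i5
    rw [stripMeasure_eq_prod] at l4 l5
    refine integral_congr_ae ?_
    filter_upwards [hwu.ae_memH1 hu.memLp hux.memLp, hw.ae_memH1 hux.memLp huxx,
      l4.prod_right_ae, l5.prod_right_ae] with t h1 h2 h3 h4
    rw [integral_add h3 h4, integral_const_mul, integral_const_mul,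
      integral_flux_mul_deriv hε h1 h2 b1 b2]
    rfl

/-- The integrated equation `u(t) = u_in + ∫₀ᵗ (∂_x R^ε + ε ∂_x² u - u ∂_x u) ds`. -/
theorem IsViscoplasticSolution.ae_eq_add_integral {T ε : ℝ} (hT : 0 < T) (hε : 0 < ε)
    {uin : ℝ → ℝ} {u ux uxx : ℝ × ℝ → ℝ} (h : IsViscoplasticSolution ε uin u ux)
    (huin : MemLp uin 2)
    (hu : MemLinftyL2 T u) (hux : MemLinftyL2 T ux) (huxx : MemLp uxx 2 (stripMeasure T))
    (hw : HasWeakDx T ux uxx) :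
    ∀ᵐ t ∂(volume.restrict (Ioo 0 T)), ∀ᵐ x,
      u (t, x) = uin x + ∫ s in Ioo 0 t, rhs ε u ux uxx (s, x) := by
  have hQ := memLp_rhs hε (h.weakDx T hT) hu hux huxx
  have hQt : ∀ t ∈ Ioo 0 T, MemLp (rhs ε u ux uxx) 2
      ((volume.restrict (Ioo 0 t)).prod (volume : Measure ℝ)) := fun t ht => by
    rw [← stripMeasure_eq_prod]
    exact hQ.mono_measure (Measure.restrict_mono
      (prod_mono (Ioo_subset_Ioo_right ht.2.le) le_rfl) le_rfl)
  have key := ae_eq_zero_of_integral_test (T := T)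
    (D := fun p => u p - (uin p.2 + ∫ s in Ioo 0 p.1, rhs ε u ux uxx (s, p.2))) ?_ ?_
  · filter_upwards [key] with t ht
    filter_upwards [ht] with x hx
    linarith
  · filter_upwards [memLp_slice hu.memLp, ae_restrict_mem measurableSet_Ioo] with t h1 h2
    exact h1.sub (huin.add (memLp_integral_left (hQt t h2)))
  · intro β b1 b2
    have hB := MemH1.of_contDiff b1 b2
    filter_upwards [h.integral_slice hT hε hu hux huxx hw b1 b2, memLp_slice hu.memLp,
      ae_restrict_mem measurableSet_Ioo] with t h1 h2 h3
    have hK := memLp_integral_left (hQt t h3)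
    have i1 := h2.integrable_mul_two hB.memLp
    have i2 := huin.integrable_mul_two hB.memLp
    have i3 := hK.integrable_mul_two hB.memLp
    have i4 : Integrable (fun p : ℝ × ℝ => rhs ε u ux uxx p * β p.2)
        ((volume.restrict (Ioo 0 t)).prod (volume : Measure ℝ)) :=
      (hQt t h3).integrable_mul_two (hB.memLp.comp_snd _)
    have e : ∫ x, (∫ s in Ioo 0 t, rhs ε u ux uxx (s, x)) * β x
        = ∫ s in Ioo 0 t, ∫ x, rhs ε u ux uxx (s, x) * β x := by
      rw [integral_integral_swap (f := fun s x => rhs ε u ux uxx (s, x) * β x) i4]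
      simp only [integral_mul_const]
    have i5 : Integrable (fun x => uin x * β x
      + (∫ s in Ioo 0 t, rhs ε u ux uxx (s, x)) * β x) := i2.add i3
    simp only [sub_mul, add_mul]
    rw [integral_sub i1 i5, integral_add i2 i3, e, h1]
    ring

/-! ### The energy inequality -/

/-- Summation by parts for backward differences with the weight `exp (-ε t)`. The part of the
shifted integral that lies in `(-h, 0)`, where `E = c`, accounts for the term `h c`. -/
theorem integral_exp_mul_sub_shift_ge {T ε h c : ℝ} (hε : 0 < ε) (hh : 0 < h) (hhT : h < T)
    {E : ℝ → ℝ} (hc : 0 ≤ c) (hE0 : ∀ t ≤ 0, E t = c) (hE : ∀ t, 0 ≤ E t)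
    (hi : IntegrableOn E (Ioo 0 T)) :
    IntegrableOn (fun t => Real.exp (-(ε * t)) * (E t - E (t - h))) (Ioo 0 T) ∧
    (1 - Real.exp (-(ε * h))) * (∫ t in Ioo 0 T, Real.exp (-(ε * t)) * E t) - h * c
      ≤ ∫ t in Ioo 0 T, Real.exp (-(ε * t)) * (E t - E (t - h)) := by
  have hT : 0 < T := hh.trans hhT
  have hexp : Continuous fun t : ℝ => Real.exp (-(ε * t)) := by fun_prop
  have conv : ∀ f : ℝ → ℝ, ∫ t in Ioo 0 T, f t = ∫ t in 0..T, f t := fun f => by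
    rw [intervalIntegral.integral_of_le hT.le, integral_Ioc_eq_integral_Ioo]
  have i0 : IntervalIntegrable E volume 0 T :=
    (intervalIntegrable_iff_integrableOn_Ioo_of_le hT.le).2 hi
  have i1 : IntervalIntegrable E volume (-h) 0 := by
    refine (intervalIntegrable_const (c := c)).congr fun t ht => (hE0 t ?_).symm
    rw [uIoc_of_le (by linarith)] at ht
    exact ht.2
  have i2 : IntervalIntegrable E volume 0 (T - h) :=
    i0.mono_set (by rw [uIcc_of_le hT.le, uIcc_of_le (by linarith)]; gcongr; linarith)
  have i3 : IntervalIntegrable (fun t => E (t - h)) volume 0 T := by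
    have := (i1.trans i2).comp_sub_right h
    simpa using this
  have w : ∀ {f : ℝ → ℝ} {a b : ℝ}, IntervalIntegrable f volume a b →
      IntervalIntegrable (fun t => Real.exp (-(ε * t)) * f t) volume a b := fun hf =>
    hf.continuousOn_mul hexp.continuousOn
  refine ⟨(intervalIntegrable_iff_integrableOn_Ioo_of_le hT.le).1 (w (i0.sub i3)), ?_⟩
  rw [conv, conv]
  have e1 : ∫ t in 0..T, Real.exp (-(ε * t)) * (E t - E (t - h))
      = (∫ t in 0..T, Real.exp (-(ε * t)) * E t)
        - ∫ t in 0..T, Real.exp (-(ε * t)) * E (t - h) := by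
    rw [← intervalIntegral.integral_sub (w i0) (w i3)]
    simp only [mul_sub]
  have e2 : ∫ t in 0..T, Real.exp (-(ε * t)) * E (t - h)
      = Real.exp (-(ε * h)) * ∫ t in (-h)..(T - h), Real.exp (-(ε * t)) * E t := by
    have := intervalIntegral.integral_comp_sub_right (a := 0) (b := T)
      (fun t => Real.exp (-(ε * (t + h))) * E t) h
    simp only [sub_add_cancel, zero_sub] at this
    rw [this, ← intervalIntegral.integral_const_mul]
    congr 1
    funext t
    rw [← mul_assoc, ← Real.exp_add]
    congr 2
    ring
  have e3 : ∫ t in (-h)..(T - h), Real.exp (-(ε * t)) * E t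
      = (∫ t in (-h)..0, Real.exp (-(ε * t)) * E t)
        + ∫ t in 0..(T - h), Real.exp (-(ε * t)) * E t :=
    (intervalIntegral.integral_add_adjacent_intervals (w i1) (w i2)).symm
  have b1 : ∫ t in 0..(T - h), Real.exp (-(ε * t)) * E t
      ≤ ∫ t in 0..T, Real.exp (-(ε * t)) * E t :=
    intervalIntegral.integral_mono_interval le_rfl (by linarith) (by linarith)
      (.of_forall fun t => mul_nonneg (Real.exp_pos _).le (hE t)) (w i0)
  have b2 : Real.exp (-(ε * h)) * ∫ t in (-h)..0, Real.exp (-(ε * t)) * E t ≤ h * c := by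
    rw [← intervalIntegral.integral_const_mul]
    have : ∫ t in (-h)..0, c = h * c := by simp
    rw [← this]
    refine intervalIntegral.integral_mono_on (by linarith) ((w i1).const_mul _)
      intervalIntegrable_const fun t ht => ?_
    rw [hE0 t ht.2, ← mul_assoc, ← Real.exp_add]
    refine mul_le_of_le_one_left hc (Real.exp_le_one_iff.2 ?_)
    nlinarith [ht.1]
  rw [e1, e2, e3]
  have b3 := mul_le_mul_of_nonneg_left b1 (Real.exp_pos (-(ε * h))).le
  linarith

/-- The pairing of `G` with the time translates of `Q` is continuous, and it may be averaged over
the translations. -/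
theorem translation_pairing {G Q : ℝ × ℝ → ℝ} (hG : MemLp G 2 volume) (hQ : MemLp Q 2 volume)
    (hQm : StronglyMeasurable Q) :
    Continuous (fun σ : ℝ => ∫ p, G p * Q (p - (σ, 0))) ∧
    ∀ h : ℝ, 0 ≤ h → Integrable (fun p => G p * ∫ σ in 0..h, Q (p - (σ, 0))) ∧
      ∫ p, G p * ∫ σ in 0..h, Q (p - (σ, 0)) = ∫ σ in 0..h, ∫ p, G p * Q (p - (σ, 0)) := by
  have hmp : ∀ σ : ℝ, MeasurePreserving (fun p : ℝ × ℝ => p - (σ, 0)) volume volume := fun σ =>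
    measurePreserving_sub_right volume (σ, 0)
  have hQσ : ∀ σ : ℝ, MemLp (fun p => Q (p - (σ, 0))) 2 volume := fun σ =>
    hQ.comp_measurePreserving (hmp σ)
  constructor
  · let g : ℝ → C(ℝ × ℝ, ℝ × ℝ) := fun σ => ⟨fun p => p - (σ, 0), by fun_prop⟩
    have hg : Continuous g := ContinuousMap.continuous_of_continuous_uncurry _ (by
      change Continuous fun x : ℝ × (ℝ × ℝ) => x.2 - (x.1, (0 : ℝ))
      fun_prop)
    have hc := (continuous_const (y := hQ.toLp Q)).compMeasurePreservingLp hg hmp (by simp)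
    refine ((continuous_const (y := hG.toLp G)).inner hc).congr fun σ => ?_
    rw [L2.inner_def]
    refine integral_congr_ae ?_
    filter_upwards [hG.coeFn_toLp, Lp.coeFn_compMeasurePreserving (hQ.toLp Q) (hmp σ),
      (hmp σ).quasiMeasurePreserving.ae_eq_comp hQ.coeFn_toLp] with p h1 h2 h3
    rw [h1]
    -- the coercion of the continuous map `g σ` hides the translation from `rw`
    erw [h2]
    rw [h3]
    simp [mul_comm]
  · intro h hh
    have hm : AEStronglyMeasurable (fun z : ℝ × (ℝ × ℝ) => G z.2 * Q (z.2 - (z.1, 0)))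
        ((volume.restrict (Ioc 0 h)).prod volume) := by
      refine hG.aestronglyMeasurable.comp_snd.mul
        (hQm.comp_measurable (g := fun z : ℝ × (ℝ × ℝ) => z.2 - (z.1, (0 : ℝ)))
          ?_).aestronglyMeasurable
      exact Continuous.measurable (by fun_prop)
    have hi : Integrable (fun z : ℝ × (ℝ × ℝ) => G z.2 * Q (z.2 - (z.1, 0)))
        ((volume.restrict (Ioc 0 h)).prod volume) := by
      rw [integrable_prod_iff hm]
      refine ⟨.of_forall fun σ => hG.integrable_mul_two (hQσ σ), ?_⟩
      refine Integrable.of_bound (C := (∫ p, G p ^ 2) + ∫ p, Q p ^ 2)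
        hm.norm.integral_prod_right' (.of_forall fun σ => ?_)
      rw [Real.norm_of_nonneg (integral_nonneg fun _ => norm_nonneg _)]
      have e : ∫ p, Q p ^ 2 = ∫ p, Q (p - (σ, 0)) ^ 2 :=
        ((hmp σ).integral_comp (MeasurableEquiv.subRight ((σ, 0) : ℝ × ℝ)).measurableEmbedding
          fun p => Q p ^ 2).symm
      rw [e, ← integral_add hG.integrable_sq (hQσ σ).integrable_sq]
      refine integral_mono (hG.integrable_mul_two (hQσ σ)).norm
        (hG.integrable_sq.add (hQσ σ).integrable_sq) fun p => ?_
      simp only [norm_mul, Real.norm_eq_abs]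
      nlinarith [sq_nonneg (|G p| - |Q (p - (σ, 0))|), sq_abs (G p), sq_abs (Q (p - (σ, 0))),
        sq_nonneg (G p), sq_nonneg (Q (p - (σ, 0)))]
    have e : ∀ p, G p * ∫ σ in 0..h, Q (p - (σ, 0))
        = ∫ σ in Ioc 0 h, G p * Q (p - (σ, 0)) := fun p => by
      rw [intervalIntegral.integral_of_le hh, integral_const_mul]
    simp only [e]
    rw [intervalIntegral.integral_of_le hh]
    exact ⟨hi.integral_prod_right, (integral_integral_swap hi).symm⟩

theorem integrable_regAbs {α : Type*} [MeasurableSpace α] {μ : Measure α} {ε : ℝ} (hε : 0 < ε)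
    {b : α → ℝ} (hb : MemLp b 2 μ) : Integrable (fun x => regAbs ε (b x)) μ := by
  have hc : Continuous (regAbs ε) := by unfold regAbs; fun_prop
  refine (hb.integrable_sq.const_mul ε⁻¹).mono'
    (hc.comp_aestronglyMeasurable hb.aestronglyMeasurable) (.of_forall fun x => ?_)
  rw [Real.norm_of_nonneg (regAbs_nonneg _ _)]
  exact regAbs_le_sq hε _

/-- Convexity of `b ↦ ∫ regAbs ε b`, integrated by parts. -/
theorem MemH1.integral_regAbs_sub_le {ε : ℝ} (hε : 0 < ε) {a b c p q : ℝ → ℝ} (h1 : MemH1 a b)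
    (h2 : MemH1 b c) (h3 : MemH1 p q) :
    (∫ x, regAbs ε (b x)) - ∫ x, regAbs ε (q x)
      ≤ -∫ x, regSignDeriv ε (b x) * c x * (a x - p x) := by
  have hr := h2.regSign hε
  have hd := h1.sub h3
  rw [← hr.integral_mul_eq_neg hd,
    ← integral_sub (integrable_regAbs hε h2.memLp) (integrable_regAbs hε h3.memLp_deriv)]
  exact integral_mono ((integrable_regAbs hε h2.memLp).sub (integrable_regAbs hε h3.memLp_deriv))
    (hr.memLp.integrable_mul_two hd.memLp_deriv) fun x => regAbs_sub_le hε _ _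

/-- The integrated form of `E' = -∫ R_x ∂_t u` with the weight `exp (-ε t)`, as an inequality, for
`E(t) = ∫ regAbs ε (∂_x u(t))` and `∂_t u = Q`, `u(0) = uin`. -/
theorem energy_inequality {T ε : ℝ} (hT : 0 < T) (hε : 0 < ε) {u ux uxx Q : ℝ × ℝ → ℝ}
    {uin uin' : ℝ → ℝ} (hux : MemLp ux 2 (stripMeasure T)) (huxx : MemLp uxx 2 (stripMeasure T))
    (h1 : ∀ᵐ t ∂(volume.restrict (Ioo 0 T)), MemH1 (fun x => u (t, x)) (fun x => ux (t, x)))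
    (h2 : ∀ᵐ t ∂(volume.restrict (Ioo 0 T)), MemH1 (fun x => ux (t, x)) (fun x => uxx (t, x)))
    (hin : MemH1 uin uin') (hQm : StronglyMeasurable Q) (hQ : MemLp Q 2 volume)
    (hQ0 : ∀ s x, s ≤ 0 → Q (s, x) = 0)
    (hu : ∀ᵐ t ∂(volume.restrict (Ioo 0 T)), ∀ᵐ x, u (t, x) = uin x + ∫ s in 0..t, Q (s, x)) :
    ε * (∫ t in Ioo 0 T, Real.exp (-(ε * t)) * ∫ x, regAbs ε (ux (t, x)))
      + ∫ t in Ioo 0 T, Real.exp (-(ε * t)) * ∫ x, stressDx ε ux uxx (t, x) * Q (t, x)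
      ≤ ∫ x, regAbs ε (uin' x) := by
  -- `v` and `vx` extend `u` and `ux` by the initial datum to negative times
  let v : ℝ → ℝ → ℝ := fun t x => if t ≤ 0 then uin x else u (t, x)
  let vx : ℝ → ℝ → ℝ := fun t x => if t ≤ 0 then uin' x else ux (t, x)
  let E : ℝ → ℝ := fun t => ∫ x, regAbs ε (vx t x)
  set c := ∫ x, regAbs ε (uin' x) with hc
  have hc0 : 0 ≤ c := integral_nonneg fun _ => regAbs_nonneg _ _
  have hE0 : ∀ t ≤ 0, E t = c := fun t ht => by simp [E, vx, ht, hc]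
  have hEnn : ∀ t, 0 ≤ E t := fun t => integral_nonneg fun _ => regAbs_nonneg _ _
  have hvpos : ∀ t, 0 < t → (v t = fun x => u (t, x)) ∧ (vx t = fun x => ux (t, x)) := fun t ht =>
    ⟨funext fun x => if_neg (not_le.2 ht), funext fun x => if_neg (not_le.2 ht)⟩
  have hvneg : ∀ t, t ≤ 0 → (v t = uin) ∧ (vx t = uin') := fun t ht =>
    ⟨funext fun x => if_pos ht, funext fun x => if_pos ht⟩
  have hEpos : ∀ t ∈ Ioo 0 T, E t = ∫ x, regAbs ε (ux (t, x)) := fun t ht => by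
    simp only [E, (hvpos t ht.1).2]
  have hEi : IntegrableOn E (Ioo 0 T) := by
    have := integrable_regAbs hε hux
    rw [stripMeasure_eq_prod] at this
    refine IntegrableOn.congr_fun this.integral_prod_left (fun t ht => (hEpos t ht).symm)
      measurableSet_Ioo
  -- the integrated equation holds at almost all times `t < T`, trivially for `t ≤ 0`
  have good : ∀ᵐ t, t < T → MemH1 (v t) (vx t) ∧
      ∀ᵐ x, v t x = uin x + ∫ s in 0..t, Q (s, x) := by
    filter_upwards [(ae_restrict_iff' measurableSet_Ioo).1 h1,
      (ae_restrict_iff' measurableSet_Ioo).1 hu] with t k1 k2 htT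
    rcases le_or_gt t 0 with ht | ht
    · rw [(hvneg t ht).1, (hvneg t ht).2]
      refine ⟨hin, .of_forall fun x => ?_⟩
      rw [intervalIntegral.integral_zero_ae, add_zero]
      refine .of_forall fun s hs => hQ0 s x ?_
      rw [uIoc_comm, uIoc_of_le ht] at hs
      exact hs.2
    · rw [(hvpos t ht).1, (hvpos t ht).2]
      exact ⟨k1 ⟨ht, htT⟩, k2 ⟨ht, htT⟩⟩
  have hQx : ∀ᵐ x, ∀ a b : ℝ, IntervalIntegrable (fun s => Q (s, x)) volume a b := by
    have k1 := hQ.integrable_sq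
    have k2 := hQ.aestronglyMeasurable
    rw [Measure.volume_eq_prod] at k1 k2
    filter_upwards [k1.prod_left_ae] with x h3 a b
    have h5 := ((memLp_two_iff_integrable_sq
      (hQm.comp_measurable (by fun_prop : Measurable fun s : ℝ => (s, x))).aestronglyMeasurable).2
        h3).locallyIntegrable (by norm_num)
    exact intervalIntegrable_iff.mpr <|
      (h5.integrableOn_isCompact isCompact_uIcc).mono_set uIoc_subset_uIcc
  let G : ℝ × ℝ → ℝ := (strip T).indicator fun p => Real.exp (-(ε * p.1)) * stressDx ε ux uxx p
  have hstrip : MeasurableSet (strip T) := measurableSet_Ioo.prod .univ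
  have hG : MemLp G 2 volume := by
    rw [memLp_indicator_iff_restrict hstrip]
    refine (memLp_stressDx hε hux huxx).of_le_mul (c := 1)
      ((Continuous.aestronglyMeasurable (by fun_prop)).mul
        (memLp_stressDx hε hux huxx).aestronglyMeasurable) ?_
    filter_upwards [ae_restrict_mem hstrip] with p hp
    rw [norm_mul, Real.norm_of_nonneg (Real.exp_pos _).le]
    refine mul_le_mul_of_nonneg_right (Real.exp_le_one_iff.2 ?_) (norm_nonneg _)
    have : 0 < p.1 := hp.1.1
    have := mul_pos hε this
    linarith
  obtain ⟨hJ, hJ'⟩ := translation_pairing hG hQ hQm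
  set J : ℝ → ℝ := fun σ => ∫ p, G p * Q (p - (σ, 0)) with hJdef
  -- pairing with `G` as an iterated integral
  have iter : ∀ S : ℝ × ℝ → ℝ, Integrable (fun p => G p * S p) →
      IntegrableOn (fun t => Real.exp (-(ε * t)) * ∫ x, stressDx ε ux uxx (t, x) * S (t, x))
        (Ioo 0 T) ∧
      ∫ p, G p * S p
        = ∫ t in Ioo 0 T, Real.exp (-(ε * t)) * ∫ x, stressDx ε ux uxx (t, x) * S (t, x) := by
    intro S hS
    have e : (fun p => G p * S p) = (strip T).indicator
        fun p => Real.exp (-(ε * p.1)) * (stressDx ε ux uxx p * S p) := by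
      funext p
      by_cases hp : p ∈ strip T
      · simp only [G, indicator_of_mem hp, mul_assoc]
      · simp only [G, indicator_of_notMem hp, zero_mul]
    rw [e, integrable_indicator_iff hstrip] at hS
    have hS' := hS
    change Integrable _ (stripMeasure T) at hS'
    rw [stripMeasure_eq_prod] at hS'
    rw [e, integral_indicator hstrip, integral_strip hS]
    have hl := hS'.integral_prod_left
    simp only [integral_const_mul] at hl ⊢
    exact ⟨hl, trivial⟩
  have step : ∀ h, 0 < h → h < T →
      (1 - Real.exp (-(ε * h))) * (∫ t in Ioo 0 T, Real.exp (-(ε * t)) * E t) - h * c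
        ≤ -∫ σ in 0..h, J σ := by
    intro h hh hhT
    obtain ⟨hi, hge⟩ := integral_exp_mul_sub_shift_ge hε hh hhT hc0 hE0 hEnn hEi
    obtain ⟨j1, j2⟩ := hJ' h hh.le
    obtain ⟨j3, j4⟩ := iter _ j1
    refine hge.trans ?_
    rw [← j2, j4, ← integral_neg]
    refine integral_mono_ae hi j3.neg ?_
    have good' := (measurePreserving_sub_right (volume : Measure ℝ)
      h).quasiMeasurePreserving.ae good
    filter_upwards [h2, ae_restrict_of_ae good, ae_restrict_of_ae good',
      ae_restrict_mem measurableSet_Ioo] with t k1 k2 k3 ht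
    obtain ⟨m1, m2⟩ := k2 ht.2
    obtain ⟨m3, m4⟩ := k3 (by linarith [ht.2])
    have k1' : MemH1 (vx t) (fun x => uxx (t, x)) := by rw [(hvpos t ht.1).2]; exact k1
    refine le_of_le_of_eq (mul_le_mul_of_nonneg_left ?_ (Real.exp_pos _).le) (mul_neg _ _)
    refine (m1.integral_regAbs_sub_le hε k1' m3).trans_eq (congrArg _ (integral_congr_ae ?_))
    filter_upwards [m2, m4, hQx] with x n1 n2 n3
    rw [n1, n2, (hvpos t ht.1).2]
    have n4 := intervalIntegral.integral_comp_sub_left (a := 0) (b := h) (fun s => Q (s, x)) t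
    have n5 := intervalIntegral.integral_interval_sub_left (n3 0 t) (n3 0 (t - h))
    simp only [Prod.mk_sub_mk, sub_zero] at n4 ⊢
    rw [n4, ← n5]
    unfold stressDx
    ring
  -- divide by `h` and let `h → 0`
  have lim1 : Tendsto (fun h : ℝ => h⁻¹ * ((1 - Real.exp (-(ε * h)))
      * (∫ t in Ioo 0 T, Real.exp (-(ε * t)) * E t) - h * c)) (𝓝[>] 0)
      (𝓝 (ε * (∫ t in Ioo 0 T, Real.exp (-(ε * t)) * E t) - c)) := by
    have hd : HasDerivAt (fun h : ℝ => (1 - Real.exp (-(ε * h)))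
      * (∫ t in Ioo 0 T, Real.exp (-(ε * t)) * E t) - h * c)
      (ε * (∫ t in Ioo 0 T, Real.exp (-(ε * t)) * E t) - c) 0 := by
      have d1 : HasDerivAt (fun h : ℝ => 1 - Real.exp (-(ε * h))) ε 0 := by
        have := ((((hasDerivAt_id (0 : ℝ)).const_mul ε).fun_neg).exp).const_sub 1
        refine this.congr_deriv (by simp)
      exact ((d1.mul_const _).sub ((hasDerivAt_id (0 : ℝ)).mul_const c)).congr_deriv (by simp)
    have := hd.tendsto_slope_zero_right
    simpa using this
  have lim2 : Tendsto (fun h : ℝ => h⁻¹ * -∫ σ in 0..h, J σ) (𝓝[>] 0) (𝓝 (-J 0)) := by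
    have hd := (intervalIntegral.integral_hasDerivAt_right (hJ.intervalIntegrable 0 0)
      hJ.aestronglyMeasurable.stronglyMeasurableAtFilter hJ.continuousAt).fun_neg
    have := hd.tendsto_slope_zero_right
    simpa using this
  have fin := le_of_tendsto_of_tendsto lim1 lim2 (by
    filter_upwards [Ioo_mem_nhdsGT hT] with h hh
    exact mul_le_mul_of_nonneg_left (step h hh.1 hh.2) (inv_nonneg.2 hh.1.le))
  have eJ : J 0 = ∫ t in Ioo 0 T, Real.exp (-(ε * t)) *
      ∫ x, stressDx ε ux uxx (t, x) * Q (t, x) := by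
    rw [← (iter Q (hG.integrable_mul_two hQ)).2, hJdef]
    refine integral_congr_ae (.of_forall fun p => ?_)
    simp only
    rw [show p - ((0 : ℝ), (0 : ℝ)) = p from sub_zero p]
  have eE : ∫ t in Ioo 0 T, Real.exp (-(ε * t)) * E t
      = ∫ t in Ioo 0 T, Real.exp (-(ε * t)) * ∫ x, regAbs ε (ux (t, x)) :=
    setIntegral_congr_fun measurableSet_Ioo fun t ht => by simp only [hEpos t ht]
  rw [eE, eJ] at fin
  linarith

/-! ### The uniform bound on the stress derivative and the limit -/

/-- The initial energy is bounded by the total variation of the initial datum. -/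
theorem MemH1.integral_regAbs_deriv_le {ε : ℝ} (hε : 0 < ε) {a b c : ℝ → ℝ} (h1 : MemH1 a b)
    (h2 : MemH1 b c) (htv : totalVariation a ≠ ⊤) :
    ∫ x, regAbs ε (b x) ≤ (totalVariation a).toReal := by
  have hr := (h2.regSign hε).neg
  refine le_trans ?_ (hr.integral_mul_deriv_le_totalVariation
    (fun x => by rw [abs_neg]; exact abs_regSign_le hε _) h1.memLp htv)
  rw [h1.integral_mul_eq_neg hr, ← integral_neg]
  refine integral_mono (integrable_regAbs hε h2.memLp)
    (h2.memLp.integrable_mul_two hr.memLp).neg fun x => ?_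
  simp only [mul_neg, neg_neg]
  exact regAbs_le_mul_regSign hε _

/-- The terms `ε ∂_x² u` and `-u ∂_x u` of the equation tested with the stress derivative, at a
fixed time, for `a = u`, `b = ∂_x u` and `c = ∂_x² u`. -/
theorem MemH1.integral_sq_sub_le {ε : ℝ} (hε : 0 < ε) {a b c : ℝ → ℝ} (h1 : MemH1 a b)
    (h2 : MemH1 b c) (hab : MemLp (fun x => a x * b x) 2) :
    (∫ x, (regSignDeriv ε (b x) * c x) ^ 2) - ε * ∫ x, regAbs ε (b x)
      ≤ ∫ x, regSignDeriv ε (b x) * c x * (regSignDeriv ε (b x) * c x + ε * c x - a x * b x) := by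
  have hr := h2.regSign hε
  have hf := h2.regFlux hε
  have i1 := hr.memLp_deriv.integrable_sq
  have i2 := (hr.memLp_deriv.integrable_mul_two h2.memLp_deriv).const_mul ε
  have i3 := hr.memLp_deriv.integrable_mul_two hab
  have i12 : Integrable (fun x => (regSignDeriv ε (b x) * c x) ^ 2
    + ε * (regSignDeriv ε (b x) * c x * c x)) := i1.add i2
  have e1 : ∫ x, regSignDeriv ε (b x) * c x * (regSignDeriv ε (b x) * c x + ε * c x - a x * b x)
      = (∫ x, (regSignDeriv ε (b x) * c x) ^ 2) + (∫ x, ε * (regSignDeriv ε (b x) * c x * c x))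
        - ∫ x, regSignDeriv ε (b x) * c x * (a x * b x) := by
    rw [← integral_add i1 i2, ← integral_sub i12 i3]
    exact integral_congr_ae (.of_forall fun x => by simp only; ring)
  -- the sign of the viscous term
  have n2 : 0 ≤ ∫ x, ε * (regSignDeriv ε (b x) * c x * c x) := integral_nonneg fun x => by
    have := mul_nonneg (regSignDeriv_nonneg ε (b x)) (mul_self_nonneg (c x))
    simp only [Pi.zero_apply]
    rw [mul_assoc]
    positivity
  -- the convective term, as `b * regSignDeriv ε b * c` is the derivative of `regFlux ε b`
  have e3 : ∫ x, regSignDeriv ε (b x) * c x * (a x * b x)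
      = -∫ x, b x * PlasticBurgers.regFlux ε (b x) := by
    rw [← h1.integral_mul_eq_neg hf]
    exact integral_congr_ae (.of_forall fun x => by simp only; ring)
  have n3 : -(ε * ∫ x, regAbs ε (b x)) ≤ ∫ x, b x * PlasticBurgers.regFlux ε (b x) := by
    rw [← integral_const_mul, ← integral_neg]
    exact integral_mono ((integrable_regAbs hε h2.memLp).const_mul ε).neg
      (h2.memLp.integrable_mul_two hf.memLp)
      fun x => (abs_le.1 (abs_mul_regFlux_le hε (b x))).1
  rw [e1, e3]
  linarith

/-- The bound on the stress derivative in `L²`, uniform in `ε` as long as `ε` is bounded. -/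
theorem IsViscoplasticSolution.integral_stressDx_sq_le {T ε : ℝ} (hT : 0 < T) (hε : 0 < ε)
    {uin : ℝ → ℝ} {u ux uxx : ℝ × ℝ → ℝ} (h : IsViscoplasticSolution ε uin u ux)
    (huin : MemH2 uin) (htv : totalVariation uin ≠ ⊤)
    (hu : MemLinftyL2 T u) (hux : MemLinftyL2 T ux) (huxx : MemLp uxx 2 (stripMeasure T))
    (hw : HasWeakDx T ux uxx) :
    ∫ p in strip T, stressDx ε ux uxx p ^ 2 ≤ Real.exp (ε * T) * (totalVariation uin).toReal := by
  obtain ⟨uin', uin'', k1, k2, l0, l1, l2⟩ := huin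
  have hin : MemH1 uin uin' := ⟨l0, l1, k1.eq⟩
  have hin' : MemH1 uin' uin'' := ⟨l1, l2, k2.eq⟩
  have hwu := h.weakDx T hT
  have hQ := memLp_rhs hε hwu hu hux huxx
  have hRx := memLp_stressDx hε hux.memLp huxx
  have hprod := memLp_mul_weakDx hwu hu hux
  have h1 := hwu.ae_memH1 hu.memLp hux.memLp
  have h2 := hw.ae_memH1 hux.memLp huxx
  have hstrip : MeasurableSet (strip T) := measurableSet_Ioo.prod .univ
  -- a Borel version of the right-hand side that vanishes outside of the strip
  let Q : ℝ × ℝ → ℝ := (strip T).indicator (hQ.aestronglyMeasurable.mk _)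
  have hQm : StronglyMeasurable Q := hQ.aestronglyMeasurable.stronglyMeasurable_mk.indicator hstrip
  have hQe : rhs ε u ux uxx =ᵐ[stripMeasure T] Q := by
    filter_upwards [hQ.aestronglyMeasurable.ae_eq_mk, ae_restrict_mem hstrip] with p h3 h4
    rw [h3]; exact (indicator_of_mem h4 _).symm
  have hQL : MemLp Q 2 volume := (memLp_indicator_iff_restrict hstrip).2
    (hQ.ae_eq hQ.aestronglyMeasurable.ae_eq_mk)
  have hQ0 : ∀ s x, s ≤ 0 → Q (s, x) = 0 := fun s x hs =>
    indicator_of_notMem (fun hm => absurd hm.1.1 (not_lt.2 hs)) _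
  have hQs : ∀ᵐ x, ∀ᵐ s ∂(volume.restrict (Ioo 0 T)), rhs ε u ux uxx (s, x) = Q (s, x) := by
    have := hQe
    rw [stripMeasure_eq_prod] at this
    exact Measure.ae_ae_of_ae_prod
      (Measure.measurePreserving_swap.quasiMeasurePreserving.ae this)
  have hrep : ∀ᵐ t ∂(volume.restrict (Ioo 0 T)), ∀ᵐ x,
      u (t, x) = uin x + ∫ s in 0..t, Q (s, x) := by
    filter_upwards [h.ae_eq_add_integral hT hε l0 hu hux huxx hw,
      ae_restrict_mem measurableSet_Ioo] with t m1 ht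
    filter_upwards [m1, hQs] with x m2 m3
    rw [m2, intervalIntegral.integral_of_le ht.1.le, integral_Ioc_eq_integral_Ioo]
    exact congrArg _ (integral_congr_ae
      (ae_mono (Measure.restrict_mono (Ioo_subset_Ioo_right ht.2.le) le_rfl) m3))
  have key := (energy_inequality hT hε hux.memLp huxx h1 h2 hin hQm hQL hQ0 hrep).trans
    (hin.integral_regAbs_deriv_le hε hin' htv)
  have wi : ∀ {f : ℝ × ℝ → ℝ}, Integrable f (stripMeasure T) →
      IntegrableOn (fun t => Real.exp (-(ε * t)) * ∫ x, f (t, x)) (Ioo 0 T) := fun hf => by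
    rw [stripMeasure_eq_prod] at hf
    refine hf.integral_prod_left.bdd_mul (c := 1)
      (Continuous.aestronglyMeasurable (by fun_prop)) ?_
    filter_upwards [ae_restrict_mem measurableSet_Ioo] with t ht
    rw [Real.norm_of_nonneg (Real.exp_pos _).le]
    refine Real.exp_le_one_iff.2 ?_
    have := mul_pos hε ht.1
    linarith
  have w1 := wi hRx.integrable_sq
  have w2 := wi (integrable_regAbs hε hux.memLp)
  have w3 := wi (hRx.integrable_mul_two (hQ.ae_eq hQe))
  have main : (∫ t in Ioo 0 T, Real.exp (-(ε * t)) * ∫ x, stressDx ε ux uxx (t, x) ^ 2)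
      - ε * (∫ t in Ioo 0 T, Real.exp (-(ε * t)) * ∫ x, regAbs ε (ux (t, x)))
      ≤ ∫ t in Ioo 0 T, Real.exp (-(ε * t)) * ∫ x, stressDx ε ux uxx (t, x) * Q (t, x) := by
    rw [← integral_const_mul, ← integral_sub w1 (w2.const_mul ε)]
    refine integral_mono_ae (w1.sub (w2.const_mul ε)) w3 ?_
    filter_upwards [h1, h2, memLp_slice hprod, ae_ae_of_ae_strip hQe] with t m1 m2 m3 m4
    have := mul_le_mul_of_nonneg_left (m1.integral_sq_sub_le hε m2 m3)
      (Real.exp_pos (-(ε * t))).le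
    rw [mul_sub] at this
    have e : ∫ x, stressDx ε ux uxx (t, x) * Q (t, x)
        = ∫ x, stressDx ε ux uxx (t, x) * rhs ε u ux uxx (t, x) :=
      integral_congr_ae (m4.mono fun x hx => by simp only [hx])
    simp only [e]
    refine le_trans (le_of_eq ?_) this
    unfold stressDx
    ring
  have low : Real.exp (-(ε * T)) * ∫ p in strip T, stressDx ε ux uxx p ^ 2
      ≤ ∫ t in Ioo 0 T, Real.exp (-(ε * t)) * ∫ x, stressDx ε ux uxx (t, x) ^ 2 := by
    rw [integral_strip hRx.integrable_sq, ← integral_const_mul]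
    have hl := hRx.integrable_sq
    rw [stripMeasure_eq_prod] at hl
    refine integral_mono_ae (hl.integral_prod_left.const_mul _) w1 ?_
    filter_upwards [ae_restrict_mem measurableSet_Ioo] with t ht
    refine mul_le_mul_of_nonneg_right (Real.exp_le_exp.2 ?_)
      (integral_nonneg fun _ => sq_nonneg _)
    have := mul_le_mul_of_nonneg_left ht.2.le hε.le
    linarith
  have fin : Real.exp (-(ε * T)) * ∫ p in strip T, stressDx ε ux uxx p ^ 2
      ≤ (totalVariation uin).toReal := by linarith
  rwa [Real.exp_neg, inv_mul_le_iff₀ (Real.exp_pos _)] at fin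

theorem norm_sq_toLp {T : ℝ} {f : ℝ × ℝ → ℝ} (hf : MemLp f 2 (stripMeasure T)) :
    ‖hf.toLp f‖ ^ 2 = ∫ p in strip T, f p ^ 2 := by
  rw [← real_inner_self_eq_norm_sq, L2.inner_def]
  refine integral_congr_ae ?_
  filter_upwards [hf.coeFn_toLp] with x e1
  rw [e1]; simp [pow_two]

theorem functional_neg_weakDx_test {T : ℝ} {f φ : ℝ × ℝ → ℝ} {g : X T} (h : HasWeakDx T f g)
    (hφ : IsTest T φ) : functional (-g) hφ.toX = ∫ p in strip T, f p * dx φ p := by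
  rw [functional_apply, h.eq φ hφ, ← integral_neg]
  refine integral_congr_ae ?_
  filter_upwards [Lp.coeFn_neg g, hφ.memLp.coeFn_toLp] with p h1 h2
  rw [h1, IsTest.toX, h2, Pi.neg_apply, neg_mul]

theorem tendsto_integral_mul_dx {T : ℝ} {F : ℕ → ℝ × ℝ → ℝ} {R φ : ℝ × ℝ → ℝ}
    (h : ∀ r > 0, TendstoWeakStarLinfty (volume.restrict (Ioo (0 : ℝ) T ×ˢ Ioo (-r) r)) F R)
    (hφ : IsTest T φ) :
    Tendsto (fun n => ∫ p in strip T, F n p * dx φ p) atTop (𝓝 (∫ p in strip T, R p * dx φ p)) := by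
  have hdx : Continuous (dx φ) :=
    (hφ.smooth.continuous_fderiv (by simp)).clm_apply continuous_const
  have hdxc : HasCompactSupport (dx φ) :=
    (hφ.compact.fderiv ℝ).comp_left (g := fun L : ℝ × ℝ →L[ℝ] ℝ => L (0, 1)) rfl
  obtain ⟨r, hr0, hr⟩ := hdxc.isCompact.isBounded.subset_ball_lt 0 0
  have e : ∀ f : ℝ × ℝ → ℝ, ∫ p in strip T, f p * dx φ p
      = ∫ p in Ioo (0 : ℝ) T ×ˢ Ioo (-r) r, f p * dx φ p := fun f => by
    refine setIntegral_eq_of_subset_of_forall_sdiff_eq_zero (measurableSet_Ioo.prod .univ)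
      (prod_mono le_rfl (subset_univ _)) fun p hp => ?_
    rw [image_eq_zero_of_notMem_tsupport (f := dx φ) fun hs => hp.2 ⟨hp.1.1, ?_⟩, mul_zero]
    have := hr hs
    rw [Metric.mem_ball, dist_zero_right] at this
    exact abs_lt.1 ((norm_snd_le p).trans_lt this)
  simp only [e]
  exact (h r hr0).2.2 _ (hdx.integrable_of_hasCompactSupport hdxc).integrableOn

/-- The sequential Banach–Alaoglu theorem in the dual of `X`. -/
theorem exists_weakStar_subseq {T M : ℝ} (η : ℕ → StrongDual ℝ (X T)) (h : ∀ n, ‖η n‖ ≤ M) :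
    ∃ (k : ℕ → ℕ) (ζ : StrongDual ℝ (X T)), StrictMono k ∧
      ∀ v, Tendsto (fun n => η (k n) v) atTop (𝓝 (ζ v)) := by
  have : Fact ((2 : ℝ≥0∞) ≠ ⊤) := ⟨by simp⟩
  obtain ⟨ζ, -, k, hk, hlim⟩ := WeakDual.isSeqCompact_closedBall ℝ (X T) 0 M
    (x := fun n => StrongDual.toWeakDual (η n)) fun n => by
      simpa using! h n
  exact ⟨k, WeakDual.toStrongDual ζ, hk, fun v =>
    ((WeakDual.eval_continuous v).tendsto ζ).comp hlim⟩

end PlasticBurgers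

theorem theorem3p3 (T : ℝ) (hT : 0 < T) :
    -- for every `ε > 0`, the element `-∂_x R^ε` of `X*` belongs to `∂Ψ(0)`
    (∀ (ε : ℝ) (uin : ℝ → ℝ) (u ux : ℝ × ℝ → ℝ), 0 < ε → MemH2 uin →
      IsViscoplasticSolution ε uin u ux →
      ∃ g : X T, HasWeakDx T (stress ε ux) g ∧
        functional (-g) ∈ subdifferential (Psi T) 0) ∧
    -- the limit `ε → 0`
    (∀ (ε : ℕ → ℝ) (uin : ℕ → ℝ → ℝ) (u ux : ℕ → ℝ × ℝ → ℝ) (R : ℝ × ℝ → ℝ),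
      (∀ n, 0 < ε n) → Tendsto ε atTop (𝓝 0) →
      (∀ n, MemH2 (uin n)) →
      (∃ C : ℝ≥0, ∀ n, eLpNorm (uin n) 2 volume ≤ C ∧ totalVariation (uin n) ≤ C) →
      (∀ n, IsViscoplasticSolution (ε n) (uin n) (u n) (ux n)) →
      (∀ S > 0, ∀ r > 0, TendstoWeakStarLinfty
        (volume.restrict (Ioo (0 : ℝ) S ×ˢ Ioo (-r) r)) (fun n => stress (ε n) (ux n)) R) →
      ∃ g : ℕ → X T, (∀ n, HasWeakDx T (stress (ε n) (ux n)) (g n)) ∧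
        ∃ (k : ℕ → ℕ) (ζ : StrongDual ℝ (X T)), StrictMono k ∧
          -- weak-* convergence in `Y*`
          (∀ v ∈ Y T, Tendsto (fun n => functional (-(g (k n))) v) atTop (𝓝 (ζ v))) ∧
          -- `ζ = -D_x R` in the sense of distributions
          (∀ (φ : ℝ × ℝ → ℝ) (hφ : IsTest T φ),
            ζ hφ.toX = ∫ p in strip T, R p * dx φ p) ∧
          ζ ∈ subdifferential (Psi T) 0) := by
  refine ⟨fun ε uin u ux hε _ h => ?_, fun ε uin u ux R hε hε0 hin hC h hR => ?_⟩
  · obtain ⟨uxx, ut, utx, hreg⟩ := h.regularity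
    obtain ⟨hw, -, -, -, hux, huxx, -⟩ := hreg T hT
    exact ⟨_, hw.stress_toLp hε hux.memLp huxx.memLp, mem_subdifferential_Psi_zero fun _ =>
      functional_neg_stressDx_le hε hw hux.memLp huxx.memLp⟩
  · choose uxx ut utx hreg using fun n => (h n).regularity
    have hw n := (hreg n T hT).1
    have hu n := (hreg n T hT).2.2.2.1
    have hux n := (hreg n T hT).2.2.2.2.1
    have huxx n := (hreg n T hT).2.2.2.2.2.1.memLp
    obtain ⟨C, hC⟩ := hC
    obtain ⟨M, hM⟩ := hε0.bddAbove_range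
    let g : ℕ → X T := fun n => (memLp_stressDx (hε n) (hux n).memLp (huxx n)).toLp _
    have hg n : HasWeakDx T (stress (ε n) (ux n)) (g n) :=
      (hw n).stress_toLp (hε n) (hux n).memLp (huxx n)
    have hgY n : ∀ w ∈ Y T, functional (-(g n)) w ≤ (Psi T w).toReal := fun _ =>
      functional_neg_stressDx_le (hε n) (hw n) (hux n).memLp (huxx n)
    have hbound n : ‖functional (-(g n))‖ ≤ √(Real.exp (M * T) * C) := by
      have e : ‖functional (-(g n))‖ = ‖g n‖ := by
        rw [functional, LinearIsometryEquiv.norm_map, norm_neg]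
      rw [e]
      refine Real.le_sqrt_of_sq_le ?_
      rw [norm_sq_toLp]
      have htv : totalVariation (uin n) ≠ ⊤ := ((hC n).2.trans_lt ENNReal.coe_lt_top).ne
      refine ((h n).integral_stressDx_sq_le hT (hε n) (hin n) htv (hu n) (hux n) (huxx n)
        (hw n)).trans ?_
      refine mul_le_mul (Real.exp_le_exp.2 (mul_le_mul_of_nonneg_right (hM ⟨n, rfl⟩) hT.le))
        (ENNReal.toReal_le_coe_of_le_coe (hC n).2) ENNReal.toReal_nonneg (Real.exp_pos _).le
    obtain ⟨k, ζ, hk, hζ⟩ := exists_weakStar_subseq _ hbound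
    refine ⟨g, hg, k, ζ, hk, fun v _ => hζ v, fun φ hφ => ?_,
      mem_subdifferential_Psi_zero fun w hw' => ?_⟩
    · refine tendsto_nhds_unique (hζ hφ.toX) ?_
      have := (tendsto_integral_mul_dx (hR T hT) hφ).comp hk.tendsto_atTop
      refine this.congr fun n => ?_
      exact (functional_neg_weakDx_test (hg _) hφ).symm
    · exact le_of_tendsto' (hζ w) fun n => hgY (k n) w hw'
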